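/- Let $\mathbb S^3$ be the unit sphere in the quaternions $\mathbb H$, with the round metric $g$, its Levi-Civita connection $\nabla$, and the Lie group structure given by quaternion multiplication. Orient it so that the left-invariant orthonormal frame $(e_1,e_2,e_3)$ with values $i,j,k$ at $1$ is positive. Let $\Sigma\mathbb S^3$ be the real spinor bundle of rank four of its unique spin structure, on which the vectors act by Clifford multiplication with $X\cdot X\cdot{}=-|X|^2$ and the volume element $e_1e_2e_3$ acts as $-\mathrm{Id}$, with the induced connection $\nabla$. Let $\mathcal C_{\mathbb S^3}$ be the set of smooth fields $A$ of $g$-symmetric endomorphisms of $T\mathbb S^3$ for which there is a smooth spinor field $\psi$, not identically zero, with $$\nabla_X\psi=-\tfrac12 A(X)\cdot\psi\qquad\text{for all } X\in T\mathbb S^3 .$$ Let $A\in\mathcal C_{\mathbb S^3}$, and let $\xi$ be a nonzero left-invariant (resp. right-invariant) vector field on $\mathbb S^3$ such that $\mathcal L_\xi A=0$ and such that $A\xi=f\xi$ for some function $f$ on $\mathbb S^3$. Then $A=\mathrm{Id}$, or $A=-\mathrm{Id}$, or $$A=|\xi|^{-2}\,\xi\otimes\xi-3P\qquad\bigl(\text{resp.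 } A=-|\xi|^{-2}\,\xi\otimes\xi+3P\bigr),$$ where $P$ is the orthogonal projector of $T\mathbb S^3$ onto $\xi^\perp$ and $(\xi\otimes\xi)(X)=g(\xi,X)\,\xi$. (If $\xi$ has unit length, the factor $|\xi|^{-2}$ is $1$.) -/

import Mathlib

open scoped Quaternion InnerProductSpace Manifold ContDiff

noncomputable section

namespace CauchyS3

/-- The round three-sphere: the unit sphere of the quaternions. It carries Mathlib's group
structure (quaternion multiplication) and Mathlib's manifold structure. -/
abbrev S3 : Type := Metric.sphere (0 : ℍ[ℝ]) 1

instance finrank_quaternion : Fact (Module.finrank ℝ ℍ[ℝ] = 3 + 1) :=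
  ⟨Quaternion.finrank_eq_four⟩

/-- The tangent space `T_p S³ = p^⊥`, as a subspace of `ℍ`, with the induced inner product. -/
def tangentAt (p : S3) : Submodule ℝ ℍ[ℝ] := (ℝ ∙ (p : ℍ[ℝ]))ᗮ

open scoped Classical in
/-- The radial retraction `x ↦ x / ‖x‖` of `ℍ ∖ {0}` onto the sphere (with value `1` at `0`). -/
def radial (x : ℍ[ℝ]) : S3 :=
  if h : x = 0 then 1
  else ⟨‖x‖⁻¹ • x, by simp [norm_smul, h]⟩

/-- A map from the sphere to a normed space is smooth. -/
def Smooth {E : Type*} [NormedAddCommGroup E] [NormedSpace ℝ E] (f : S3 → E) : Prop :=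
  ContMDiff (𝓡 3) 𝓘(ℝ, E) ∞ f

/-- The differential `df_p(v)` of a smooth map `f` on the sphere at a tangent vector
`v ∈ T_p S³ ⊆ ℍ`, computed by extending `f` to a neighbourhood of the sphere, constantly along
rays. -/
def diff {E : Type*} [NormedAddCommGroup E] [NormedSpace ℝ E] (f : S3 → E) (p : S3) (v : ℍ[ℝ]) :
    E :=
  fderiv ℝ (fun x : ℍ[ℝ] => f (radial x)) (p : ℍ[ℝ]) v

/-- Smooth vector fields on the sphere. -/
structure IsVectorField (X : S3 → ℍ[ℝ]) : Prop where
  smooth : Smooth X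
  tangent : ∀ p, X p ∈ tangentAt p

/-- The Levi-Civita connection of the round metric: `(∇_v Y)_p` is the tangential part of
`dY_p(v)`. -/
def leviCivita (Y : S3 → ℍ[ℝ]) (p : S3) (v : ℍ[ℝ]) : ℍ[ℝ] :=
  (tangentAt p).starProjection (diff Y p v)

/-- The Lie bracket `[X, Y] = dY(X) - dX(Y)` of vector fields on the sphere. -/
def bracket (X Y : S3 → ℍ[ℝ]) (p : S3) : ℍ[ℝ] :=
  diff Y p (X p) - diff X p (Y p)

/-- A smooth field of symmetric endomorphisms of the tangent bundle of the sphere. The endomorphism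
`A p` of `T_p S³ = p^⊥` is recorded as an endomorphism of `ℍ`, extended by `0` on the normal
line `ℝ p`; by symmetry it then preserves `p^⊥`. -/
structure IsSymmEndField (A : S3 → ℍ[ℝ] →L[ℝ] ℍ[ℝ]) : Prop where
  smooth : Smooth A
  symm : ∀ p v w, ⟪A p v, w⟫_ℝ = ⟪v, A p w⟫_ℝ
  normal : ∀ p : S3, A p (p : ℍ[ℝ]) = 0

/-- The Lie derivative of an endomorphism field applied to a vector field:
`(L_ξ A) X = [ξ, A X] - A [ξ, X]`. -/
def lieDerivEnd (ξ : S3 → ℍ[ℝ]) (A : S3 → ℍ[ℝ] →L[ℝ] ℍ[ℝ]) (X : S3 → ℍ[ℝ]) (p : S3) : ℍ[ℝ] :=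
  bracket ξ (fun q => A q (X q)) p - A p (bracket ξ X p)

/-- `ξ` is invariant under (the differentials of) all left translations `p ↦ q p`. -/
def IsLeftInvariant (ξ : S3 → ℍ[ℝ]) : Prop :=
  ∀ q p : S3, ξ (q * p) = (q : ℍ[ℝ]) * ξ p

/-- `ξ` is invariant under (the differentials of) all right translations `p ↦ p q`. -/
def IsRightInvariant (ξ : S3 → ℍ[ℝ]) : Prop :=
  ∀ q p : S3, ξ (p * q) = ξ p * (q : ℍ[ℝ])

/-- The imaginary units `i, j, k`. -/
def imUnit : Fin 3 → ℍ[ℝ] :=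
  ![⟨0, 1, 0, 0⟩, ⟨0, 0, 1, 0⟩, ⟨0, 0, 0, 1⟩]

/-- The oriented orthonormal frame `(e₁, e₂, e₃)` of left-invariant vector fields with values
`i, j, k` at `1`. -/
def frame (a : Fin 3) (p : S3) : ℍ[ℝ] := (p : ℍ[ℝ]) * imUnit a

/-!
Spinors. The sphere is simply connected, so it has exactly one spin structure, and the
frame `(e₁, e₂, e₃)` lifts to a global section of it. This section identifies the (real, rank
four) spinor bundle with the trivial bundle with fibre the spinor module `ℍ`, on which `e₁, e₂, e₃`
act by left multiplication by `i, j, k`; in particular the volume element `e₁ e₂ e₃` acts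
by `-1`. Spinor fields are thus maps `S3 → ℍ`.
-/

/-- Clifford multiplication of a spinor `φ` at `p` by a tangent vector `v` at `p`. -/
def clifford (p : S3) (v φ : ℍ[ℝ]) : ℍ[ℝ] :=
  ∑ a, ⟪frame a p, v⟫_ℝ • (imUnit a * φ)

/-- The spinorial Levi-Civita connection in the frame `(e₁, e₂, e₃)`:
`∇_v ψ = dψ(v) + 1/4 ∑ g(∇_v e_a, e_b) e_a · e_b · ψ`. -/
def spinConnection (ψ : S3 → ℍ[ℝ]) (p : S3) (v : ℍ[ℝ]) : ℍ[ℝ] :=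
  diff ψ p v + (1 / 4 : ℝ) • ∑ a, ∑ b, ⟪leviCivita (frame a) p v, frame b p⟫_ℝ •
    clifford p (frame a p) (clifford p (frame b p) (ψ p))

/-- `ψ` is a Cauchy spinor with endomorphism field `A`: a spinor field that is not identically
zero, with `∇_v ψ = -1/2 A(v) · ψ` for all tangent vectors `v`. -/
structure IsCauchySpinor (A : S3 → ℍ[ℝ] →L[ℝ] ℍ[ℝ]) (ψ : S3 → ℍ[ℝ]) : Prop where
  smooth : Smooth ψ
  ne_zero : ψ ≠ 0
  eqn : ∀ p, ∀ v ∈ tangentAt p, spinConnection ψ p v = -(1 / 2 : ℝ) • clifford p (A p v) (ψ p)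

/-- The set of Cauchy endomorphisms of the sphere: the symmetric endomorphism fields that
admit a Cauchy spinor. -/
def cauchyEndomorphisms : Set (S3 → ℍ[ℝ] →L[ℝ] ℍ[ℝ]) :=
  {A | IsSymmEndField A ∧ ∃ ψ, IsCauchySpinor A ψ}

/-- The endomorphism `|x|⁻² x ⊗ x` of `ℍ`, equal to `x ⊗ x` when `x` is a unit vector. -/
def lineTensor (x v : ℍ[ℝ]) : ℍ[ℝ] := ((‖x‖ ^ 2)⁻¹ * ⟪x, v⟫_ℝ) • x

/-- The orthogonal projector of `T_p S³` onto the orthogonal complement of the tangent vector `x`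
in `T_p S³`. -/
def perpProj (p : S3) (x v : ℍ[ℝ]) : ℍ[ℝ] := (tangentAt p ⊓ (ℝ ∙ x)ᗮ).starProjection v

end CauchyS3

end

/-!
Write `p` for the point of the sphere. In the left-invariant frame the equation of a Cauchy spinor
becomes `dψ ψ⁻¹ = -1/2 p⁻¹ (A + 1)`, so `ψ` has constant length, and the integrability of this
equation constrains `A`. In the right-invariant frame `p ψ` satisfies the same kind of equation with
`A` replaced by `-A`; moreover the fields `x ↦ x u` and the fields `x ↦ -u x`, with `u` imaginary,
obey the same commutation rule. Both halves of the theorem are thus instances of `classification`,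
which is stated for an abstract framing `IsInvariantFraming`.

Let `c₁` be the direction of `ξ`, and complete it to an oriented orthonormal basis `c₁, c₂, c₃` of the
imaginary quaternions; let `∂ᵢ` be the derivatives along the corresponding fields, so that
`[∂₁, ∂₂] = 2 ∂₃` and cyclically. As `ξ` is an eigenvector, `M = -1/2 (A + 1)` has the matrix
`[[m, 0, 0], [0, a, b], [0, b, c]]`. The condition `L_ξ A = 0` gives `∂₁ M`
(`along_coeff_of_lieDerivEnd_eq_zero`). Inserting this in the integrability condition
`∂ᵢ Mⱼ - ∂ⱼ Mᵢ = [Mᵢ, Mⱼ] + 2 Mₖ` leaves (`matrix_classification`): `m` is constant,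
`(1 + m) a = (1 + m) b = (1 + m) c = 0`, `a c - b² = -m`, and the Codazzi equations `∂₂ b = ∂₃ a`,
`∂₂ c = ∂₃ b`. If `m ≠ -1`, then `M = 0`, that is `A = -1`.

If `m = -1`, the block `[[a, b], [b, c]]` is an invariant Codazzi tensor of determinant one, morally on
the two-sphere of orbits of `ξ`, and it has to be `±1`, as in the proof of Liebmann's theorem on
spheres. Up to a sign its trace is positive where the square of the trace is maximal. There the
elliptic operator `c ∂₂∂₂ - b (∂₂∂₃ + ∂₃∂₂) + a ∂₃∂₃`, applied to the trace, gives
`4 (a - c)² + 16 b²` plus squares, by the Codazzi equations, the commutators and the second derivatives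
of `a c - b² = 1`; by the maximum principle this is nonpositive (`trace_eq_two_at_max`). The two signs
yield `A = 1` and `A = |ξ|⁻² ξ ⊗ ξ - 3 P`.
-/

namespace CauchyS3

variable {E : Type*} [NormedAddCommGroup E] [NormedSpace ℝ E]

/-! ### Functions on the sphere and their radial extensions -/

theorem coe_ne_zero (p : S3) : (p : ℍ[ℝ]) ≠ 0 := ne_zero_of_mem_unit_sphere p

theorem radial_coe (p : S3) : radial (p : ℍ[ℝ]) = p := by
  ext1
  simp [radial, coe_ne_zero]

theorem coe_radial {x : ℍ[ℝ]} (hx : x ≠ 0) : (radial x : ℍ[ℝ]) = ‖x‖⁻¹ • x := by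
  simp [radial, hx]

theorem radial_smul {k : ℝ} (hk : 0 < k) (x : ℍ[ℝ]) : radial (k • x) = radial x := by
  rcases eq_or_ne x 0 with rfl | hx
  · simp
  · ext1
    rw [coe_radial hx, coe_radial (smul_ne_zero hk.ne' hx), norm_smul, smul_smul,
      Real.norm_of_nonneg hk.le]
    congr 1
    field_simp

theorem contDiffAt_coe_radial {x : ℍ[ℝ]} (hx : x ≠ 0) :
    ContDiffAt ℝ ∞ (fun y : ℍ[ℝ] => (radial y : ℍ[ℝ])) x := by
  have h : ContDiffAt ℝ ∞ (fun y : ℍ[ℝ] => ‖y‖⁻¹ • y) x :=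
    ((contDiffAt_norm ℝ hx).inv (norm_ne_zero_iff.2 hx)).smul contDiffAt_id
  refine h.congr_of_eventuallyEq ?_
  filter_upwards [isOpen_compl_singleton.mem_nhds hx] with y hy
  exact coe_radial hy

theorem contMDiffAt_radial {x : ℍ[ℝ]} (hx : x ≠ 0) :
    ContMDiffAt 𝓘(ℝ, ℍ[ℝ]) (𝓡 3) ∞ radial x := by
  let U : TopologicalSpace.Opens ℍ[ℝ] := ⟨{0}ᶜ, isOpen_compl_singleton⟩
  have h : ContMDiff 𝓘(ℝ, ℍ[ℝ]) 𝓘(ℝ, ℍ[ℝ]) ∞ (fun y : U => (radial (y : ℍ[ℝ]) : ℍ[ℝ])) :=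
    fun y => contMDiffAt_subtype_iff.2 (contDiffAt_coe_radial y.2).contMDiffAt
  have h2 := h.codRestrict_sphere (n := 3) (fun y => (radial (y : ℍ[ℝ])).2)
  exact (contMDiffAt_subtype_iff (f := radial) (x := (⟨x, hx⟩ : U))).1 (h2 (⟨x, hx⟩ : U))

/-- A function on the sphere is smooth if and only if its extension to `ℍ ∖ {0}`, constant along
rays, is smooth. -/
theorem smooth_iff {f : S3 → E} :
    Smooth f ↔ ∀ x : ℍ[ℝ], x ≠ 0 → ContDiffAt ℝ ∞ (fun y => f (radial y)) x := by
  constructor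
  · intro hf x hx
    exact (ContMDiffAt.comp x (hf (radial x)) (contMDiffAt_radial hx)).contDiffAt
  · intro hf p
    have h := ContMDiffAt.comp (I := 𝓡 3) (x := p)
      ((hf _ (coe_ne_zero p)).contMDiffAt) (contMDiff_coe_sphere (E := ℍ[ℝ]) (n := 3) p)
    refine h.congr_of_eventuallyEq (Filter.Eventually.of_forall fun q => ?_)
    simp only [Function.comp_apply, radial_coe]

theorem Smooth.contDiffAt {f : S3 → E} (hf : Smooth f) (p : S3) :
    ContDiffAt ℝ ∞ (fun y => f (radial y)) (p : ℍ[ℝ]) :=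
  smooth_iff.1 hf _ (coe_ne_zero p)

theorem Smooth.differentiableAt {f : S3 → E} (hf : Smooth f) (p : S3) :
    DifferentiableAt ℝ (fun y => f (radial y)) (p : ℍ[ℝ]) :=
  (hf.contDiffAt p).differentiableAt (by simp)

theorem smooth_const (c : E) : Smooth (fun _ : S3 => c) :=
  smooth_iff.2 fun _ _ => contDiffAt_const

theorem smooth_clm (L : ℍ[ℝ] →L[ℝ] E) : Smooth (fun p : S3 => L p) :=
  smooth_iff.2 fun _ hx => L.contDiff.contDiffAt.comp _ (contDiffAt_coe_radial hx)

theorem Smooth.add {f g : S3 → E} (hf : Smooth f) (hg : Smooth g) :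
    Smooth (fun p => f p + g p) :=
  smooth_iff.2 fun x hx => (smooth_iff.1 hf x hx).add (smooth_iff.1 hg x hx)

theorem Smooth.neg {f : S3 → E} (hf : Smooth f) : Smooth (fun p => -f p) :=
  smooth_iff.2 fun x hx => (smooth_iff.1 hf x hx).neg

theorem Smooth.smul {f : S3 → ℝ} {g : S3 → E} (hf : Smooth f) (hg : Smooth g) :
    Smooth (fun p => f p • g p) :=
  smooth_iff.2 fun x hx => (smooth_iff.1 hf x hx).smul (smooth_iff.1 hg x hx)

theorem Smooth.mul {f g : S3 → ℝ} (hf : Smooth f) (hg : Smooth g) :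
    Smooth (fun p => f p * g p) :=
  hf.smul hg

theorem Smooth.quaternion_mul {f g : S3 → ℍ[ℝ]} (hf : Smooth f) (hg : Smooth g) :
    Smooth (fun p => f p * g p) :=
  smooth_iff.2 fun x hx => (smooth_iff.1 hf x hx).mul (smooth_iff.1 hg x hx)

theorem Smooth.clm_apply {A : S3 → ℍ[ℝ] →L[ℝ] ℍ[ℝ]} {f : S3 → ℍ[ℝ]} (hA : Smooth A)
    (hf : Smooth f) : Smooth (fun p => A p (f p)) :=
  smooth_iff.2 fun x hx => (smooth_iff.1 hA x hx).clm_apply (smooth_iff.1 hf x hx)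

theorem Smooth.inner {f g : S3 → ℍ[ℝ]} (hf : Smooth f) (hg : Smooth g) :
    Smooth (fun p => ⟪f p, g p⟫_ℝ) :=
  smooth_iff.2 fun x hx => (smooth_iff.1 hf x hx).inner ℝ (smooth_iff.1 hg x hx)

theorem Smooth.continuous {f : S3 → E} (hf : Smooth f) : Continuous f :=
  ContMDiff.continuous hf

/-! ### The differential of a function on the sphere -/

theorem diff_const (c : E) (p : S3) (v : ℍ[ℝ]) : diff (fun _ => c) p v = 0 := by
  simp [diff]

theorem diff_add {f g : S3 → E} (hf : Smooth f) (hg : Smooth g) (p : S3) (v : ℍ[ℝ]) :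
    diff (fun q => f q + g q) p v = diff f p v + diff g p v := by
  simp only [diff]
  rw [fderiv_fun_add (hf.differentiableAt p) (hg.differentiableAt p)]
  rfl

theorem diff_neg (f : S3 → E) (p : S3) (v : ℍ[ℝ]) :
    diff (fun q => -f q) p v = -diff f p v := by
  simp only [diff]
  rw [fderiv_fun_neg]
  rfl

theorem diff_smul {f : S3 → ℝ} {g : S3 → E} (hf : Smooth f) (hg : Smooth g) (p : S3)
    (v : ℍ[ℝ]) :
    diff (fun q => f q • g q) p v = diff f p v • g p + f p • diff g p v := by
  simp only [diff]
  rw [fderiv_fun_smul (hf.differentiableAt p) (hg.differentiableAt p)]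
  simp [radial_coe, add_comm]

theorem diff_mul {f g : S3 → ℝ} (hf : Smooth f) (hg : Smooth g) (p : S3) (v : ℍ[ℝ]) :
    diff (fun q => f q * g q) p v = diff f p v * g p + f p * diff g p v :=
  diff_smul hf hg p v

theorem diff_quaternion_mul {f g : S3 → ℍ[ℝ]} (hf : Smooth f) (hg : Smooth g) (p : S3)
    (v : ℍ[ℝ]) : diff (fun q => f q * g q) p v = diff f p v * g p + f p * diff g p v := by
  simp only [diff]
  rw [fderiv_fun_mul' (hf.differentiableAt p) (hg.differentiableAt p)]
  simp [radial_coe, add_comm]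

theorem diff_inner {f g : S3 → ℍ[ℝ]} (hf : Smooth f) (hg : Smooth g) (p : S3) (v : ℍ[ℝ]) :
    diff (fun q => ⟪f q, g q⟫_ℝ) p v = ⟪diff f p v, g p⟫_ℝ + ⟪f p, diff g p v⟫_ℝ := by
  simp only [diff]
  rw [fderiv_inner_apply ℝ (hf.differentiableAt p) (hg.differentiableAt p)]
  simp [radial_coe, add_comm]

theorem diff_coe (p : S3) {v : ℍ[ℝ]} (hv : ⟪(p : ℍ[ℝ]), v⟫_ℝ = 0) :
    diff (fun q => (q : ℍ[ℝ])) p v = v := by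
  have hsq : HasFDerivAt (fun y : ℍ[ℝ] => ‖y‖ ^ 2) (2 • (innerSL ℝ (p : ℍ[ℝ]))) (p : ℍ[ℝ]) :=
    (hasStrictFDerivAt_norm_sq (p : ℍ[ℝ])).hasFDerivAt
  have hd : DifferentiableAt ℝ (fun y : ℍ[ℝ] => (radial y : ℍ[ℝ])) p :=
    (contDiffAt_coe_radial (coe_ne_zero p)).differentiableAt (by simp)
  have hn : DifferentiableAt ℝ (fun y : ℍ[ℝ] => ‖y‖) p :=
    (contDiffAt_norm ℝ (coe_ne_zero p)).differentiableAt (n := 1) (by simp)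
  have hp : ‖(p : ℍ[ℝ])‖ = 1 := by simp
  -- the derivative of the norm at `p` kills `v`, since that of its square is `2⟪p, ·⟫`
  have hnv : fderiv ℝ (fun y : ℍ[ℝ] => ‖y‖) p v = 0 := by
    have h := congrArg (fun L => L v) ((hn.hasFDerivAt.pow 2).unique hsq)
    simpa [hp, hv] using h
  have he : (fun y : ℍ[ℝ] => ‖y‖ • (radial y : ℍ[ℝ])) = id := by
    funext y
    rcases eq_or_ne y 0 with rfl | hy
    · simp
    · rw [coe_radial hy, smul_smul, mul_inv_cancel₀ (norm_ne_zero_iff.2 hy), one_smul, id]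
  have h := congrArg (fun L => L v) (fderiv_fun_smul hn hd)
  rw [he] at h
  simpa [hp, hnv, diff] using h.symm

theorem diff_clm (L : ℍ[ℝ] →L[ℝ] E) (p : S3) {v : ℍ[ℝ]} (hv : ⟪(p : ℍ[ℝ]), v⟫_ℝ = 0) :
    diff (fun q => L q) p v = L v := by
  have hd : DifferentiableAt ℝ (fun y : ℍ[ℝ] => (radial y : ℍ[ℝ])) p :=
    (contDiffAt_coe_radial (coe_ne_zero p)).differentiableAt (by simp)
  have h := (L.hasFDerivAt.comp (p : ℍ[ℝ]) hd.hasFDerivAt).fderiv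
  have h' := congrArg (fun L => L v) h
  simp only [Function.comp_def, ContinuousLinearMap.comp_apply] at h'
  rw [diff, h']
  exact congrArg L (diff_coe p hv)

theorem fderiv_radial_extension (f : S3 → E) {x : ℍ[ℝ]} (hx : x ≠ 0) (v : ℍ[ℝ]) :
    fderiv ℝ (fun y => f (radial y)) x v = diff f (radial x) (‖x‖⁻¹ • v) := by
  have hk : 0 < ‖x‖⁻¹ := inv_pos.2 (norm_pos_iff.2 hx)
  have h := fderiv_comp_smul (𝕜 := ℝ) (f := fun y => f (radial y)) (x := x) ‖x‖⁻¹
  simp only [radial_smul hk] at h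
  rw [h, diff, coe_radial hx]
  simp

/-- The extension is constant along rays, so the differential vanishes in the radial direction. -/
theorem diff_radial {f : S3 → E} (hf : Smooth f) (p : S3) : diff f p (p : ℍ[ℝ]) = 0 := by
  have hc : HasDerivAt (fun s : ℝ => s • (p : ℍ[ℝ])) (p : ℍ[ℝ]) 1 := by
    simpa using (hasDerivAt_id (1 : ℝ)).smul_const (p : ℍ[ℝ])
  have hf' : HasFDerivAt (fun y => f (radial y)) (fderiv ℝ (fun y => f (radial y)) (p : ℍ[ℝ]))
      ((1 : ℝ) • (p : ℍ[ℝ])) := by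
    rw [one_smul]; exact (hf.differentiableAt p).hasFDerivAt
  have h := hf'.comp_hasDerivAt (1 : ℝ) hc
  have h2 : HasDerivAt ((fun y => f (radial y)) ∘ fun s : ℝ => s • (p : ℍ[ℝ])) 0 1 := by
    refine (hasDerivAt_const (1 : ℝ) (f p)).congr_of_eventuallyEq ?_
    filter_upwards [lt_mem_nhds (zero_lt_one' ℝ)] with s hs
    simp [radial_smul hs, radial_coe]
  exact h.unique h2

/-- A smooth function on the sphere with vanishing differential is constant. -/
theorem eq_of_diff_eq_zero {f : S3 → E} (hf : Smooth f)
    (h : ∀ (p : S3) (v : ℍ[ℝ]), ⟪(p : ℍ[ℝ]), v⟫_ℝ = 0 → diff f p v = 0) (p q : S3) : f p = f q := by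
  have hz : ∀ (p : S3) (v : ℍ[ℝ]), diff f p v = 0 := by
    intro p v
    have hv : v = ⟪(p : ℍ[ℝ]), v⟫_ℝ • (p : ℍ[ℝ]) + (v - ⟪(p : ℍ[ℝ]), v⟫_ℝ • (p : ℍ[ℝ])) := by
      abel
    have h1 := h p (v - ⟪(p : ℍ[ℝ]), v⟫_ℝ • (p : ℍ[ℝ]))
      (by simp [inner_sub_right, real_inner_smul_right])
    have h2 := diff_radial hf p
    unfold diff at *
    rw [hv, map_add, map_smul, h1, h2, smul_zero, add_zero]
  have hconn : IsPreconnected ({0}ᶜ : Set ℍ[ℝ]) := by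
    refine (isConnected_compl_singleton_of_one_lt_rank ?_ 0).isPreconnected
    rw [← Module.finrank_eq_rank, Quaternion.finrank_eq_four]
    norm_num
  have := isOpen_compl_singleton.is_const_of_fderiv_eq_zero (𝕜 := ℝ) hconn
    (f := fun y => f (radial y))
    (fun x hx => ((smooth_iff.1 hf x hx).differentiableAt (by simp)).differentiableWithinAt)
    (fun x hx => by
      ext v
      rw [fderiv_radial_extension f hx, hz]
      rfl)
    (coe_ne_zero p) (coe_ne_zero q)
  simpa [radial_coe] using this

/-! ### Invariant framings and their second-order calculus -/

/-- A framing of the sphere by the restrictions of linear vector fields `x ↦ V u x` of `ℍ`, indexed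
by the imaginary quaternions `u`, isometric and with `[V u, V w] = V (u w - w u)`. The left-invariant
fields `x u` and the opposites `-u x` of the right-invariant fields are the two examples; the sign in
the second one makes both obey the same commutation rule. -/
structure IsInvariantFraming (V : ℍ[ℝ] →L[ℝ] ℍ[ℝ] →L[ℝ] ℍ[ℝ]) : Prop where
  tangent : ∀ u : ℍ[ℝ], u.re = 0 → ∀ x, ⟪x, V u x⟫_ℝ = 0
  isometry : ∀ (u w : ℍ[ℝ]) (p : S3), ⟪V u p, V w p⟫_ℝ = ⟪u, w⟫_ℝ
  comm : ∀ u w x, V w (V u x) - V u (V w x) = V (u * w - w * u) x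
  surj : ∀ (p : S3) (v : ℍ[ℝ]), ⟪(p : ℍ[ℝ]), v⟫_ℝ = 0 → ∃ u : ℍ[ℝ], u.re = 0 ∧ V u p = v

/-- The framing by left-invariant vector fields. -/
noncomputable def leftFraming : ℍ[ℝ] →L[ℝ] ℍ[ℝ] →L[ℝ] ℍ[ℝ] := (ContinuousLinearMap.mul ℝ ℍ[ℝ]).flip

/-- The framing by the opposites of right-invariant vector fields. -/
noncomputable def rightFraming : ℍ[ℝ] →L[ℝ] ℍ[ℝ] →L[ℝ] ℍ[ℝ] := -ContinuousLinearMap.mul ℝ ℍ[ℝ]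

@[simp] theorem leftFraming_apply (u x : ℍ[ℝ]) : leftFraming u x = x * u := rfl

@[simp] theorem rightFraming_apply (u x : ℍ[ℝ]) : rightFraming u x = -(u * x) := rfl

theorem inner_eq_sum (u w : ℍ[ℝ]) :
    ⟪u, w⟫_ℝ = u.re * w.re + u.imI * w.imI + u.imJ * w.imJ + u.imK * w.imK := by
  simp [Quaternion.inner_def]

theorem sum_sq_coe (p : S3) : (p : ℍ[ℝ]).re ^ 2 + (p : ℍ[ℝ]).imI ^ 2 + (p : ℍ[ℝ]).imJ ^ 2 +
    (p : ℍ[ℝ]).imK ^ 2 = 1 := by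
  have h : ⟪(p : ℍ[ℝ]), p⟫_ℝ = 1 := by simp
  rw [inner_eq_sum] at h
  linarith

theorem inner_coe_mul_coe_mul (p : S3) (u w : ℍ[ℝ]) : ⟪(p : ℍ[ℝ]) * u, p * w⟫_ℝ = ⟪u, w⟫_ℝ := by
  have h := sum_sq_coe p
  simp only [inner_eq_sum, Quaternion.re_mul, Quaternion.imI_mul, Quaternion.imJ_mul,
    Quaternion.imK_mul]
  linear_combination (u.re * w.re + u.imI * w.imI + u.imJ * w.imJ + u.imK * w.imK) * h

theorem inner_mul_coe_mul_coe (p : S3) (u w : ℍ[ℝ]) : ⟪u * (p : ℍ[ℝ]), w * p⟫_ℝ = ⟪u, w⟫_ℝ := by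
  have h := sum_sq_coe p
  simp only [inner_eq_sum, Quaternion.re_mul, Quaternion.imI_mul, Quaternion.imJ_mul,
    Quaternion.imK_mul]
  linear_combination (u.re * w.re + u.imI * w.imI + u.imJ * w.imJ + u.imK * w.imK) * h

theorem star_mul_coe (p : S3) : star (p : ℍ[ℝ]) * p = 1 := by
  rw [Quaternion.star_mul_self, Quaternion.normSq_eq_norm_mul_self]
  simp

theorem coe_mul_star (p : S3) : (p : ℍ[ℝ]) * star (p : ℍ[ℝ]) = 1 := by
  rw [Quaternion.self_mul_star, Quaternion.normSq_eq_norm_mul_self]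
  simp

theorem isInvariantFraming_left : IsInvariantFraming leftFraming where
  tangent u hu x := by
    simp only [leftFraming_apply, inner_eq_sum, Quaternion.re_mul, Quaternion.imI_mul,
      Quaternion.imJ_mul, Quaternion.imK_mul, hu]
    ring
  isometry u w p := inner_coe_mul_coe_mul p u w
  comm u w x := by simp only [leftFraming_apply]; noncomm_ring
  surj p v hv := by
    refine ⟨star (p : ℍ[ℝ]) * v, ?_, ?_⟩
    · rw [inner_eq_sum] at hv
      simp only [Quaternion.re_mul, Quaternion.re_star, Quaternion.imI_star, Quaternion.imJ_star,
        Quaternion.imK_star]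
      linarith
    · rw [leftFraming_apply, ← mul_assoc, coe_mul_star, one_mul]

theorem isInvariantFraming_right : IsInvariantFraming rightFraming where
  tangent u hu x := by
    simp only [rightFraming_apply, inner_eq_sum, Quaternion.re_mul, Quaternion.imI_mul,
      Quaternion.imJ_mul, Quaternion.imK_mul, hu, Quaternion.re_neg, Quaternion.imI_neg,
      Quaternion.imJ_neg, Quaternion.imK_neg]
    ring
  isometry u w p := by
    simp only [rightFraming_apply, inner_neg_neg]
    exact inner_mul_coe_mul_coe p u w
  comm u w x := by simp only [rightFraming_apply]; noncomm_ring
  surj p v hv := by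
    refine ⟨-(v * star (p : ℍ[ℝ])), ?_, ?_⟩
    · rw [inner_eq_sum] at hv
      simp only [Quaternion.re_mul, Quaternion.re_star, Quaternion.imI_star, Quaternion.imJ_star,
        Quaternion.imK_star, Quaternion.re_neg]
      linarith
    · rw [rightFraming_apply, neg_mul, neg_neg, mul_assoc, star_mul_coe, mul_one]

/-- The derivative of `f` along the vector field `V u`. -/
noncomputable def along (V : ℍ[ℝ] →L[ℝ] ℍ[ℝ] →L[ℝ] ℍ[ℝ]) (u : ℍ[ℝ]) (f : S3 → E) (p : S3) : E :=
  diff f p (V u p)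

section Along

variable {V : ℍ[ℝ] →L[ℝ] ℍ[ℝ] →L[ℝ] ℍ[ℝ]}

theorem along_radial (u : ℍ[ℝ]) (f : S3 → E) {x : ℍ[ℝ]} (hx : x ≠ 0) :
    along V u f (radial x) = fderiv ℝ (fun y => f (radial y)) x (V u x) := by
  rw [fderiv_radial_extension f hx, along, coe_radial hx, map_smul]

theorem along_radial_eventuallyEq (u : ℍ[ℝ]) (f : S3 → E) {x : ℍ[ℝ]} (hx : x ≠ 0) :
    (fun y => along V u f (radial y)) =ᶠ[nhds x]
      fun y => fderiv ℝ (fun y => f (radial y)) y (V u y) := by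
  filter_upwards [isOpen_compl_singleton.mem_nhds hx] with y hy
  exact along_radial u f hy

theorem Smooth.contDiffAt_fderiv {f : S3 → E} (hf : Smooth f) {x : ℍ[ℝ]} (hx : x ≠ 0) :
    ContDiffAt ℝ ∞ (fderiv ℝ (fun y => f (radial y))) x :=
  (smooth_iff.1 hf x hx).fderiv_right (by simp)

theorem Smooth.along {f : S3 → E} (hf : Smooth f) (u : ℍ[ℝ]) : Smooth (along V u f) :=
  smooth_iff.2 fun _ hx =>
    ((hf.contDiffAt_fderiv hx).clm_apply (V u).contDiff.contDiffAt).congr_of_eventuallyEq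
      (along_radial_eventuallyEq u f hx)

theorem along_along {f : S3 → E} (hf : Smooth f) (u w : ℍ[ℝ]) (p : S3) :
    along V u (along V w f) p =
      fderiv ℝ (fderiv ℝ (fun y => f (radial y))) p (V u p) (V w p) + diff f p (V w (V u p)) := by
  rw [along, diff, (along_radial_eventuallyEq w f (coe_ne_zero p)).fderiv_eq,
    fderiv_clm_apply ((hf.contDiffAt_fderiv (coe_ne_zero p)).differentiableAt (by simp))
      (V w).differentiableAt]
  simp [diff, add_comm]

theorem IsInvariantFraming.along_comm (hV : IsInvariantFraming V) {f : S3 → E} (hf : Smooth f)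
    (u w : ℍ[ℝ]) (p : S3) :
    along V u (along V w f) p - along V w (along V u f) p = along V (u * w - w * u) f p := by
  have hsymm := (hf.contDiffAt p).isSymmSndFDerivAt
    (by simp only [minSmoothness_of_isRCLikeNormedField]; exact WithTop.coe_le_coe.2 le_top)
  rw [along_along hf, along_along hf, hsymm (V u p), along, ← hV.comm, diff, diff, diff, map_sub]
  abel

theorem along_add_left (f : S3 → E) (u w : ℍ[ℝ]) (p : S3) :
    along V (u + w) f p = along V u f p + along V w f p := by
  simp [along, diff]

theorem along_smul_left (f : S3 → E) (k : ℝ) (u : ℍ[ℝ]) (p : S3) :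
    along V (k • u) f p = k • along V u f p := by
  simp [along, diff]

theorem along_const (c : E) (u : ℍ[ℝ]) (p : S3) : along V u (fun _ => c) p = 0 :=
  diff_const c p _

theorem along_add {f g : S3 → E} (hf : Smooth f) (hg : Smooth g) (u : ℍ[ℝ]) (p : S3) :
    along V u (fun q => f q + g q) p = along V u f p + along V u g p :=
  diff_add hf hg p _

theorem along_mul {f g : S3 → ℝ} (hf : Smooth f) (hg : Smooth g) (u : ℍ[ℝ]) (p : S3) :
    along V u (fun q => f q * g q) p = along V u f p * g p + f p * along V u g p :=
  diff_mul hf hg p _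

/-! ### Necessary conditions at a maximum -/

theorem fderiv_eq_zero_of_max {f : S3 → ℝ} {p : S3} (hmax : ∀ q, f q ≤ f p) :
    fderiv ℝ (fun y => f (radial y)) (p : ℍ[ℝ]) = 0 :=
  IsLocalMax.fderiv_eq_zero (Filter.Eventually.of_forall fun y => by
    simpa [radial_coe] using hmax (radial y))

theorem along_eq_zero_of_max {f : S3 → ℝ} {p : S3} (hmax : ∀ q, f q ≤ f p) (u : ℍ[ℝ]) :
    along V u f p = 0 := by
  simp [along, diff, fderiv_eq_zero_of_max hmax]

theorem hasDerivAt_fderiv_line {G : Type*} [NormedAddCommGroup G] [NormedSpace ℝ G] {F : G → ℝ}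
    {x : G} (hF : DifferentiableAt ℝ (fderiv ℝ F) x) (v : G) :
    HasDerivAt (fun s : ℝ => fderiv ℝ F (x + s • v) v) (fderiv ℝ (fderiv ℝ F) x v v) 0 := by
  have hline : HasDerivAt (fun s : ℝ => x + s • v) v 0 := by
    simpa using ((hasDerivAt_id (0 : ℝ)).smul_const v).const_add x
  have hd : HasFDerivAt (fun y => fderiv ℝ F y v) ((fderiv ℝ (fderiv ℝ F) x).flip v)
      (x + (0 : ℝ) • v) := by
    rw [zero_smul, add_zero]
    refine (hF.hasFDerivAt.clm_apply (hasFDerivAt_const v x)).congr_fderiv ?_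
    ext w
    simp
  exact hd.comp_hasDerivAt (0 : ℝ) hline

theorem along_along_nonpos_of_max {f : S3 → ℝ} (hf : Smooth f) {p : S3}
    (hmax : ∀ q, f q ≤ f p) (u : ℍ[ℝ]) : along V u (along V u f) p ≤ 0 := by
  by_contra! hpos
  rw [along_along hf, diff, fderiv_eq_zero_of_max hmax, zero_apply, add_zero] at hpos
  set F : ℍ[ℝ] → ℝ := fun y => f (radial y) with hF
  set v := V u p
  set g : ℝ → ℝ := fun s => F (p + s • v)
  have hline : ∀ s : ℝ, HasDerivAt (fun s : ℝ => (p : ℍ[ℝ]) + s • v) v s := fun s => by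
    simpa using ((hasDerivAt_id s).smul_const v).const_add (p : ℍ[ℝ])
  have hcont : Filter.Tendsto (fun s : ℝ => (p : ℍ[ℝ]) + s • v) (nhds 0) (nhds (p : ℍ[ℝ])) := by
    simpa using (hline 0).continuousAt.tendsto
  have hderiv : deriv g =ᶠ[nhds 0] fun s => fderiv ℝ F (p + s • v) v := by
    filter_upwards [hcont (isOpen_compl_singleton.mem_nhds (coe_ne_zero p))] with s hs
    exact (((smooth_iff.1 hf _ hs).differentiableAt (by simp)).hasFDerivAt.comp_hasDerivAt s
      (hline s)).deriv
  have h2 : deriv (deriv g) 0 = fderiv ℝ (fderiv ℝ F) p v v := by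
    rw [hderiv.deriv_eq]
    exact (hasDerivAt_fderiv_line
      ((hf.contDiffAt_fderiv (coe_ne_zero p)).differentiableAt (by simp)) v).deriv
  have h1 : deriv g 0 = 0 := by
    rw [hderiv.eq_of_nhds]
    simp [hF, fderiv_eq_zero_of_max hmax]
  have hc : ContinuousAt g 0 := by
    have : ContinuousAt F ((p : ℍ[ℝ]) + (0 : ℝ) • v) := by
      simpa using (hf.differentiableAt p).continuousAt
    exact ContinuousAt.comp (f := fun s : ℝ => (p : ℍ[ℝ]) + s • v) this (hline 0).continuousAt
  -- a positive second derivative makes `0` a minimum of `g` as well, so `g` is locally constant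
  have hmin := isLocalMin_of_deriv_deriv_pos (h2 ▸ hpos) h1 hc
  have hconst : g =ᶠ[nhds 0] fun _ => g 0 := by
    filter_upwards [hmin] with s hs
    refine le_antisymm ?_ hs
    simpa [g, F, radial_coe] using hmax (radial (p + s • v))
  have h3 : deriv (deriv g) 0 = 0 := by
    rw [hconst.deriv.deriv_eq]
    simp
  rw [← h2, h3] at hpos
  exact lt_irrefl _ hpos

theorem hessian_nonpos_of_max {f : S3 → ℝ} (hf : Smooth f) {p : S3} (hmax : ∀ q, f q ≤ f p)
    (u w : ℍ[ℝ]) (k l : ℝ) :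
    k ^ 2 * along V u (along V u f) p +
      k * l * (along V u (along V w f) p + along V w (along V u f) p) +
      l ^ 2 * along V w (along V w f) p ≤ 0 := by
  have h := along_along_nonpos_of_max (V := V) hf hmax (k • u + l • w)
  rw [along_along hf, diff, fderiv_eq_zero_of_max hmax, zero_apply, add_zero] at h
  simp only [along_along hf, diff, fderiv_eq_zero_of_max hmax, zero_apply, add_zero]
  simp only [map_add, map_smul, add_apply, smul_apply, smul_eq_mul] at h
  linarith

end Along

/-! ### Oriented orthonormal frames of the imaginary quaternions -/

/-- `c₁, c₂, c₃` is an oriented orthonormal basis of the imaginary quaternions. The orientation is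
expressed through the commutators `[cᵢ, cⱼ] = 2 cₖ`. -/
structure IsOrientedFrame (c₁ c₂ c₃ : ℍ[ℝ]) : Prop where
  re₁ : c₁.re = 0
  re₂ : c₂.re = 0
  re₃ : c₃.re = 0
  comm₁₂ : c₁ * c₂ - c₂ * c₁ = (2 : ℝ) • c₃
  comm₂₃ : c₂ * c₃ - c₃ * c₂ = (2 : ℝ) • c₁
  comm₃₁ : c₃ * c₁ - c₁ * c₃ = (2 : ℝ) • c₂
  inner₁₁ : ⟪c₁, c₁⟫_ℝ = 1
  inner₂₂ : ⟪c₂, c₂⟫_ℝ = 1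
  inner₃₃ : ⟪c₃, c₃⟫_ℝ = 1
  inner₁₂ : ⟪c₁, c₂⟫_ℝ = 0
  inner₁₃ : ⟪c₁, c₃⟫_ℝ = 0
  inner₂₃ : ⟪c₂, c₃⟫_ℝ = 0
  span : ∀ u : ℍ[ℝ], u.re = 0 → ∃ x y z : ℝ, u = x • c₁ + y • c₂ + z • c₃

@[simp] theorem imUnit_re (a : Fin 3) : (imUnit a).re = 0 := by fin_cases a <;> rfl

@[simp] theorem imUnit_imI (a : Fin 3) : (imUnit a).imI = if a = 0 then 1 else 0 := by
  fin_cases a <;> rfl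

@[simp] theorem imUnit_imJ (a : Fin 3) : (imUnit a).imJ = if a = 1 then 1 else 0 := by
  fin_cases a <;> rfl

@[simp] theorem imUnit_imK (a : Fin 3) : (imUnit a).imK = if a = 2 then 1 else 0 := by
  fin_cases a <;> rfl

/-- The frame obtained from `i, j, k` by conjugation with a unit quaternion. -/
theorem isOrientedFrame_conj (q : S3) :
    IsOrientedFrame (q * imUnit 0 * star (q : ℍ[ℝ])) (q * imUnit 1 * star (q : ℍ[ℝ]))
      (q * imUnit 2 * star (q : ℍ[ℝ])) := by
  have hre : ∀ u : ℍ[ℝ], u.re = 0 → ((q : ℍ[ℝ]) * u * star (q : ℍ[ℝ])).re = 0 := by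
    intro u hu
    simp only [Quaternion.re_mul, Quaternion.imI_mul, Quaternion.imJ_mul, Quaternion.imK_mul,
      Quaternion.re_star, Quaternion.imI_star, Quaternion.imJ_star, Quaternion.imK_star, hu]
    ring
  have hre' : ∀ u : ℍ[ℝ], u.re = 0 → (star (q : ℍ[ℝ]) * u * (q : ℍ[ℝ])).re = 0 := by
    intro u hu
    simp only [Quaternion.re_mul, Quaternion.imI_mul, Quaternion.imJ_mul, Quaternion.imK_mul,
      Quaternion.re_star, Quaternion.imI_star, Quaternion.imJ_star, Quaternion.imK_star, hu]
    ring
  have hmul : ∀ u w : ℍ[ℝ], (q * u * star (q : ℍ[ℝ])) * (q * w * star (q : ℍ[ℝ])) =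
      q * (u * w) * star (q : ℍ[ℝ]) := by
    intro u w
    calc (q * u * star (q : ℍ[ℝ])) * (q * w * star (q : ℍ[ℝ]))
        = q * u * (star (q : ℍ[ℝ]) * q) * w * star (q : ℍ[ℝ]) := by noncomm_ring
      _ = q * (u * w) * star (q : ℍ[ℝ]) := by rw [star_mul_coe]; noncomm_ring
  have hcomm : ∀ u w z : ℍ[ℝ], u * w - w * u = (2 : ℝ) • z →
      (q * u * star (q : ℍ[ℝ])) * (q * w * star (q : ℍ[ℝ])) -
        (q * w * star (q : ℍ[ℝ])) * (q * u * star (q : ℍ[ℝ])) =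
      (2 : ℝ) • (q * z * star (q : ℍ[ℝ])) := by
    intro u w z h
    rw [hmul, hmul, ← sub_mul, ← mul_sub, h, mul_smul_comm, smul_mul_assoc]
  have hstar : ∀ u w : ℍ[ℝ], ⟪u * star (q : ℍ[ℝ]), w * star (q : ℍ[ℝ])⟫_ℝ = ⟪u, w⟫_ℝ := by
    intro u w
    exact inner_mul_coe_mul_coe ⟨star (q : ℍ[ℝ]), by simp⟩ u w
  have hinner : ∀ u w : ℍ[ℝ], ⟪q * u * star (q : ℍ[ℝ]), q * w * star (q : ℍ[ℝ])⟫_ℝ = ⟪u, w⟫_ℝ := by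
    intro u w
    rw [hstar, inner_coe_mul_coe_mul]
  refine ⟨hre _ rfl, hre _ rfl, hre _ rfl, hcomm _ _ _ (by ext <;> simp; norm_num),
    hcomm _ _ _ (by ext <;> simp; norm_num), hcomm _ _ _ (by ext <;> simp; norm_num),
    ?_, ?_, ?_, ?_, ?_, ?_, ?_⟩
  iterate 6
    rw [hinner, inner_eq_sum]; simp
  intro u hu
  set w := star (q : ℍ[ℝ]) * u * (q : ℍ[ℝ]) with hw
  have hwu : u = q * w * star (q : ℍ[ℝ]) := by
    calc u = ((q : ℍ[ℝ]) * star (q : ℍ[ℝ])) * u * (q * star (q : ℍ[ℝ])) := by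
          rw [coe_mul_star, one_mul, mul_one]
      _ = q * w * star (q : ℍ[ℝ]) := by rw [hw]; noncomm_ring
  have hwe : w = w.imI • imUnit 0 + w.imJ • imUnit 1 + w.imK • imUnit 2 := by
    have := hre' u hu
    ext <;> simp [hw, this]
  refine ⟨w.imI, w.imJ, w.imK, ?_⟩
  conv_lhs => rw [hwu, hwe]
  simp only [mul_add, add_mul, mul_smul_comm, smul_mul_assoc]

theorem exists_isOrientedFrame {c : ℍ[ℝ]} (hre : c.re = 0) (hc : ⟪c, c⟫_ℝ = 1) :
    ∃ c₂ c₃, IsOrientedFrame c c₂ c₃ := by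
  have hsq : c * c = -1 := by
    rw [inner_eq_sum] at hc
    ext <;> simp [hre] <;> nlinarith
  have hi : imUnit 0 * imUnit 0 = -1 := by ext <;> simp
  suffices h : ∃ q : ℍ[ℝ], q ≠ 0 ∧ c * q = q * imUnit 0 by
    obtain ⟨q, hq, hcq⟩ := h
    have hr : c * (radial q : ℍ[ℝ]) = radial q * imUnit 0 := by
      rw [coe_radial hq, mul_smul_comm, hcq, smul_mul_assoc]
    have hr' : c = radial q * imUnit 0 * star (radial q : ℍ[ℝ]) := by
      rw [← hr, mul_assoc, coe_mul_star, mul_one]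
    have hF := isOrientedFrame_conj (radial q)
    rw [← hr'] at hF
    exact ⟨_, _, hF⟩
  -- `1 - c i` conjugates `i` to `c`, unless it vanishes
  by_cases h : c = -imUnit 0
  · refine ⟨imUnit 1, fun h0 => ?_, ?_⟩
    · simpa [imUnit] using congrArg (fun x : ℍ[ℝ] => x.imJ) h0
    · rw [h]
      ext <;> simp
  · refine ⟨1 - c * imUnit 0, fun h0 => h ?_, ?_⟩
    · have : c * (1 - c * imUnit 0) = c + imUnit 0 := by
        rw [mul_sub, mul_one, ← mul_assoc, hsq]; noncomm_ring
      rw [h0, mul_zero] at this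
      exact eq_neg_of_add_eq_zero_left this.symm
    · rw [mul_sub, sub_mul, mul_one, one_mul, ← mul_assoc, hsq, mul_assoc c, hi]
      noncomm_ring

section Frame

variable {c₁ c₂ c₃ : ℍ[ℝ]}

theorem IsOrientedFrame.inner_comb (hc : IsOrientedFrame c₁ c₂ c₃) (x y z x' y' z' : ℝ) :
    ⟪x • c₁ + y • c₂ + z • c₃, x' • c₁ + y' • c₂ + z' • c₃⟫_ℝ = x * x' + y * y' + z * z' := by
  simp only [inner_add_left, inner_add_right, real_inner_smul_left, real_inner_smul_right,
    hc.inner₁₁, hc.inner₂₂, hc.inner₃₃, hc.inner₁₂, hc.inner₁₃, hc.inner₂₃,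
    real_inner_comm c₁ c₂, real_inner_comm c₁ c₃, real_inner_comm c₂ c₃,
    ]
  ring

theorem IsOrientedFrame.eq_zero (hc : IsOrientedFrame c₁ c₂ c₃) {x y z : ℝ}
    (h : x • c₁ + y • c₂ + z • c₃ = 0) : x = 0 ∧ y = 0 ∧ z = 0 := by
  have h1 := hc.inner_comb x y z x y z
  rw [h, inner_zero_left] at h1
  refine ⟨?_, ?_, ?_⟩ <;> nlinarith [sq_nonneg x, sq_nonneg y, sq_nonneg z]

end Frame

section Core

variable {V : ℍ[ℝ] →L[ℝ] ℍ[ℝ] →L[ℝ] ℍ[ℝ]} {c₁ c₂ c₃ : ℍ[ℝ]}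

theorem eq_of_along_eq_zero (hV : IsInvariantFraming V) (hc : IsOrientedFrame c₁ c₂ c₃)
    {f : S3 → ℝ} (hf : Smooth f) (h₁ : ∀ p, along V c₁ f p = 0) (h₂ : ∀ p, along V c₂ f p = 0)
    (h₃ : ∀ p, along V c₃ f p = 0) (p q : S3) : f p = f q := by
  refine eq_of_diff_eq_zero hf (fun p v hv => ?_) p q
  obtain ⟨u, hu, rfl⟩ := hV.surj p v hv
  obtain ⟨x, y, z, rfl⟩ := hc.span u hu
  change along V _ f p = 0
  simp [along_add_left, along_smul_left, h₁, h₂, h₃]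

/-! ### The maximum principle for Codazzi tensors of determinant one -/

theorem along_along_add {f g : S3 → ℝ} (hf : Smooth f) (hg : Smooth g) (u w : ℍ[ℝ]) (p : S3) :
    along V u (along V w fun q => f q + g q) p =
      along V u (along V w f) p + along V u (along V w g) p := by
  rw [show along V w (fun q => f q + g q) = fun q => along V w f q + along V w g q from
    funext fun q => along_add hf hg w q, along_add (hf.along w) (hg.along w)]

theorem along_det {a b c : S3 → ℝ} (ha : Smooth a) (hb : Smooth b) (hc : Smooth c)
    (hdet : ∀ p, a p * c p - b p * b p = 1) (u : ℍ[ℝ]) (p : S3) :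
    along V u a p * c p + a p * along V u c p - 2 * (b p * along V u b p) = 0 := by
  have h := along_const (V := V) (1 : ℝ) u p
  rw [show (fun _ : S3 => (1 : ℝ)) = fun q => a q * c q + -(b q * b q) from
    funext fun q => by rw [← hdet q, sub_eq_add_neg], along_add (ha.mul hc) (hb.mul hb).neg,
    along_mul ha hc, along, along, along, diff_neg, diff_mul hb hb] at h
  simp only [along]
  linarith

theorem along_along_det {a b c : S3 → ℝ} (ha : Smooth a) (hb : Smooth b) (hc : Smooth c)
    (hdet : ∀ p, a p * c p - b p * b p = 1) (u : ℍ[ℝ]) (p : S3) :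
    along V u (along V u a) p * c p + 2 * (along V u a p * along V u c p) +
      a p * along V u (along V u c) p - 2 * along V u b p ^ 2 -
      2 * (b p * along V u (along V u b) p) = 0 := by
  have h := along_const (V := V) (0 : ℝ) u p
  rw [show (fun _ : S3 => (0 : ℝ)) = fun q => (along V u a q * c q + a q * along V u c q) +
      (-2) * (b q * along V u b q) from
    funext fun q => by rw [← along_det ha hb hc hdet u q]; ring,
    along_add (((ha.along u).mul hc).add (ha.mul (hc.along u)))
      ((smooth_const (-2)).mul (hb.mul (hb.along u))),
    along_add ((ha.along u).mul hc) (ha.mul (hc.along u)),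
    along_mul (ha.along u) hc, along_mul ha (hc.along u),
    along_mul (smooth_const _) (hb.mul (hb.along u)), along_mul hb (hb.along u),
    along_const] at h
  linarith

/-- The pointwise computation behind the maximum principle for a symmetric matrix `[[a, b], [b, c]]`
of determinant one with positive trace. In the names of the variables, `aᵢ` and `aᵢⱼ` stand for the
derivatives `∂ᵢ a` and `∂ᵢ ∂ⱼ a`, and `kᵢ` for `∂ᵢ c`; the Codazzi equations `∂₂ b = ∂₃ a`, `∂₂ c = ∂₃ b` have been used to
eliminate `∂₂ ∂₂ b`, `∂₃ ∂₂ b`, `∂₂ ∂₂ c` and `∂₃ ∂₂ c`. -/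
theorem trace_eq_two_of_hessian_nonpos {a b c a₂ a₃ b₂ b₃ k₂ k₃ a₂₂ a₂₃ a₃₂ a₃₃ b₂₃ b₃₃ c₂₃ c₃₃ : ℝ}
    (hdet : a * c - b * b = 1) (hpos : 0 < a + c)
    (ka : a₂₃ - a₃₂ = 2 * (4 * b)) (kb : b₂₃ - a₃₃ = 2 * (2 * (c - a)))
    (kc : c₂₃ - b₃₃ = 2 * -(4 * b))
    (d₂ : a₂₂ * c + 2 * (a₂ * k₂) + a * b₂₃ - 2 * b₂ ^ 2 - 2 * (b * a₂₃) = 0)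
    (d₃ : a₃₃ * c + 2 * (a₃ * k₃) + a * c₃₃ - 2 * b₃ ^ 2 - 2 * (b * b₃₃) = 0)
    (g₂ : a₂ + k₂ = 0) (g₃ : a₃ + k₃ = 0)
    (hess : c ^ 2 * (a₂₂ + b₂₃) + c * -b * (a₂₃ + c₂₃ + (a₃₂ + b₃₃)) + (-b) ^ 2 * (a₃₃ + c₃₃) ≤ 0)
    (hess₃ : a₃₃ + c₃₃ ≤ 0) : a + c = 2 := by
  have hc : 0 < c := by
    by_contra! hle
    nlinarith [mul_self_nonneg b]
  have hlin : c * (a₂₂ + b₂₃) + a * (a₃₃ + c₃₃) - b * (a₂₃ + c₂₃ + (a₃₂ + b₃₃)) =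
      4 * (c - a) ^ 2 + 16 * b ^ 2 + 2 * b₂ ^ 2 + 2 * b₃ ^ 2 + 2 * a₂ ^ 2 + 2 * a₃ ^ 2 := by
    linear_combination d₂ + d₃ + (c - a) * kb + b * ka - b * kc - 2 * a₂ * g₂ - 2 * a₃ * g₃
  have hle : c * (4 * (c - a) ^ 2 + 16 * b ^ 2 + 2 * b₂ ^ 2 + 2 * b₃ ^ 2 + 2 * a₂ ^ 2 +
      2 * a₃ ^ 2) ≤ 0 := by
    rw [← hlin]
    refine le_of_eq_of_le ?_ (add_nonpos hess hess₃)
    linear_combination (a₃₃ + c₃₃) * hdet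
  have hsum := nonpos_of_mul_nonpos_right hle hc
  have h₂ := sq_nonneg b₂
  have h₃ := sq_nonneg b₃
  have h₄ := sq_nonneg a₂
  have h₅ := sq_nonneg a₃
  have hac := sq_nonneg (c - a)
  have hb := sq_nonneg b
  have hsq : (a + c) ^ 2 = 2 ^ 2 := by
    have h : (a + c) ^ 2 = 4 + (c - a) ^ 2 + 4 * b ^ 2 := by linear_combination 4 * hdet
    linarith
  exact (sq_eq_sq₀ hpos.le two_pos.le).1 hsq

/-- Let `[[a, b], [b, c]]` be a symmetric tensor of determinant one on the plane field spanned by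
`V c₂, V c₃`, which satisfies the Codazzi equations and is invariant under the flow of `V c₁`. Where
its trace is positive and maximal, the trace is `2`, its value at the identity: the operator
`c ∂₂∂₂ - b (∂₂∂₃ + ∂₃∂₂) + a ∂₃∂₃` is elliptic there, and maps the trace to `4 (a - c)² + 16 b²` plus
squares of first derivatives. -/
theorem trace_eq_two_at_max (hV : IsInvariantFraming V) (hF : IsOrientedFrame c₁ c₂ c₃)
    {a b c : S3 → ℝ} (ha : Smooth a) (hb : Smooth b) (hc : Smooth c)
    (hdet : ∀ p, a p * c p - b p * b p = 1)
    (hcod₁ : ∀ p, along V c₂ b p = along V c₃ a p) (hcod₂ : ∀ p, along V c₂ c p = along V c₃ b p)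
    (hLa : ∀ p, along V c₁ a p = 4 * b p) (hLb : ∀ p, along V c₁ b p = 2 * (c p - a p))
    (hLc : ∀ p, along V c₁ c p = -(4 * b p))
    {p : S3} (hmax : ∀ q, a q + c q ≤ a p + c p) (hpos : 0 < a p + c p) :
    a p + c p = 2 := by
  have hcomm : ∀ {f : S3 → ℝ}, Smooth f →
      along V c₂ (along V c₃ f) p - along V c₃ (along V c₂ f) p = 2 * along V c₁ f p :=
    fun hf => by rw [hV.along_comm hf, hF.comm₂₃, along_smul_left, smul_eq_mul]
  have ka := hcomm ha
  have kb := hcomm hb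
  have kc := hcomm hc
  rw [hLa] at ka
  rw [hLb] at kb
  rw [hLc] at kc
  have e₁ : along V c₂ b = along V c₃ a := funext hcod₁
  have e₂ : along V c₂ c = along V c₃ b := funext hcod₂
  have b22 : along V c₂ (along V c₂ b) p = along V c₂ (along V c₃ a) p := by rw [e₁]
  have b32 : along V c₃ (along V c₂ b) p = along V c₃ (along V c₃ a) p := by rw [e₁]
  have c22 : along V c₂ (along V c₂ c) p = along V c₂ (along V c₃ b) p := by rw [e₂]
  have c32 : along V c₃ (along V c₂ c) p = along V c₃ (along V c₃ b) p := by rw [e₂]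
  have d2 := along_along_det (V := V) ha hb hc hdet c₂ p
  have d3 := along_along_det (V := V) ha hb hc hdet c₃ p
  have g2 := along_eq_zero_of_max (V := V) (f := fun q => a q + c q) hmax c₂
  have g3 := along_eq_zero_of_max (V := V) (f := fun q => a q + c q) hmax c₃
  rw [along_add ha hc] at g2 g3
  have hess := hessian_nonpos_of_max (V := V) (f := fun q => a q + c q) (ha.add hc) hmax c₂ c₃
    (c p) (-b p)
  have hess3 := along_along_nonpos_of_max (V := V) (f := fun q => a q + c q) (ha.add hc) hmax c₃
  simp only [along_along_add ha hc] at hess hess3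
  rw [b22] at d2
  rw [b32] at kb
  rw [c22] at d2 hess
  rw [c32] at hess kc
  exact trace_eq_two_of_hessian_nonpos (hdet p) hpos ka kb kc d2 d3 g2 g3 hess hess3

theorem along_neg (f : S3 → ℝ) (u : ℍ[ℝ]) (p : S3) :
    along V u (fun q => -f q) p = -along V u f p :=
  diff_neg f p _

/-- An invariant Codazzi tensor of determinant one is `±1`. -/
theorem eq_one_or_neg_one_of_det_eq_one (hV : IsInvariantFraming V)
    (hF : IsOrientedFrame c₁ c₂ c₃)
    {a b c : S3 → ℝ} (ha : Smooth a) (hb : Smooth b) (hc : Smooth c)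
    (hdet : ∀ p, a p * c p - b p * b p = 1)
    (hcod₁ : ∀ p, along V c₂ b p = along V c₃ a p) (hcod₂ : ∀ p, along V c₂ c p = along V c₃ b p)
    (hLa : ∀ p, along V c₁ a p = 4 * b p) (hLb : ∀ p, along V c₁ b p = 2 * (c p - a p))
    (hLc : ∀ p, along V c₁ c p = -(4 * b p)) :
    (∀ p, a p = 1 ∧ b p = 0 ∧ c p = 1) ∨ (∀ p, a p = -1 ∧ b p = 0 ∧ c p = -1) := by
  obtain ⟨p, hp⟩ : ∃ p, ∀ q, (a q + c q) ^ 2 ≤ (a p + c p) ^ 2 := by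
    obtain ⟨p, -, hp⟩ := isCompact_univ.exists_isMaxOn (Set.univ_nonempty (α := S3))
      ((ha.continuous.add hc.continuous).pow 2).continuousOn
    exact ⟨p, fun q => hp (Set.mem_univ q)⟩
  have hge : ∀ q, (a q + c q) ^ 2 = 4 + (a q - c q) ^ 2 + 4 * b q ^ 2 := fun q => by
    linear_combination 4 * hdet q
  have h4 : (a p + c p) ^ 2 = 4 := by
    have hne : a p + c p ≠ 0 := fun h => by
      have := hge p
      rw [h] at this
      nlinarith [sq_nonneg (a p - c p), sq_nonneg (b p)]
    rcases lt_or_gt_of_ne hne with hneg | hpos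
    · -- replace the tensor by its opposite
      have h := trace_eq_two_at_max (p := p) hV hF ha.neg hb.neg hc.neg
        (fun q => by linear_combination hdet q)
        (fun q => by rw [along_neg, along_neg, hcod₁]) (fun q => by rw [along_neg, along_neg, hcod₂])
        (fun q => by rw [along_neg, hLa]; ring) (fun q => by rw [along_neg, hLb]; ring)
        (fun q => by rw [along_neg, hLc]; ring)
        (fun q => by
          have := abs_le_of_sq_le_sq' (hp q |>.trans_eq (neg_sq _).symm) (by linarith)
          linarith)
        (by linarith)
      have h' : a p + c p = -2 := by linarith
      rw [h']; norm_num
    · rw [trace_eq_two_at_max hV hF ha hb hc hdet hcod₁ hcod₂ hLa hLb hLc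
        (fun q => (abs_le_of_sq_le_sq' (hp q) hpos.le).2) hpos]
      norm_num
  have hab : ∀ q, a q = c q ∧ b q = 0 := fun q => by
    have h1 := hge q
    have h2 := hp q
    have h3 : (a q - c q) ^ 2 = 0 := le_antisymm (by nlinarith [sq_nonneg (b q)]) (sq_nonneg _)
    have h5 : b q ^ 2 = 0 := le_antisymm (by nlinarith [sq_nonneg (a q - c q)]) (sq_nonneg _)
    exact ⟨sub_eq_zero.1 (pow_eq_zero_iff two_ne_zero |>.1 h3), pow_eq_zero_iff two_ne_zero |>.1 h5⟩
  have hsq : ∀ q, a q * a q = 1 := fun q => by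
    have := hdet q
    rw [(hab q).2, ← (hab q).1] at this
    linarith
  have hconst : ∀ q, a q = a p := fun q => by
    have h0 : ∀ (u : ℍ[ℝ]) (q : S3), along V u a q = 0 := fun u q => by
      have h := along_const (V := V) (1 : ℝ) u q
      rw [show (fun _ : S3 => (1 : ℝ)) = fun q => a q * a q from funext fun q => (hsq q).symm,
        along_mul ha ha] at h
      have hne : a q ≠ 0 := fun h0 => by simpa [h0] using hsq q
      have : along V u a q * a q = 0 := by linarith
      exact (mul_eq_zero.1 this).resolve_right hne
    exact eq_of_along_eq_zero hV hF ha (h0 c₁) (h0 c₂) (h0 c₃) q p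
  rcases mul_self_eq_one_iff.1 (hsq p) with h | h
  · exact Or.inl fun q => ⟨(hconst q).trans h, (hab q).2, (hab q).1 ▸ (hconst q).trans h⟩
  · exact Or.inr fun q => ⟨(hconst q).trans h, (hab q).2, (hab q).1 ▸ (hconst q).trans h⟩

/-! ### Integrability of the spinor equation -/

/-- The compatibility condition for `∂_u ψ = M ψ`, `∂_w ψ = N ψ`. -/
theorem integrability (hV : IsInvariantFraming V) {ψ M N K : S3 → ℍ[ℝ]} (hψ : Smooth ψ)
    (hM : Smooth M) (hN : Smooth N) {u w : ℍ[ℝ]} (hu : ∀ p, along V u ψ p = M p * ψ p)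
    (hw : ∀ p, along V w ψ p = N p * ψ p)
    (huw : ∀ p, along V (u * w - w * u) ψ p = K p * ψ p) {p : S3} (hp : ψ p ≠ 0) :
    along V u N p - along V w M p = M p * N p - N p * M p + K p := by
  have h := hV.along_comm hψ u w p
  rw [huw, show along V w ψ = fun q => N q * ψ q from funext hw,
    show along V u ψ = fun q => M q * ψ q from funext hu, along, along,
    diff_quaternion_mul hN hψ, diff_quaternion_mul hM hψ] at h
  change along V u N p * ψ p + N p * along V u ψ p -
    (along V w M p * ψ p + M p * along V w ψ p) = _ at h
  rw [hu, hw] at h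
  refine mul_right_cancel₀ hp ?_
  rw [sub_mul, add_mul, ← h]
  noncomm_ring

theorem along_smul_const {f : S3 → ℝ} (hf : Smooth f) (k : ℍ[ℝ]) (u : ℍ[ℝ]) (p : S3) :
    along V u (fun q => f q • k) p = along V u f p • k := by
  rw [along, diff_smul hf (smooth_const k), diff_const, smul_zero, add_zero, along]

theorem along_smul_const_add {f g : S3 → ℝ} (hf : Smooth f) (hg : Smooth g) (k l : ℍ[ℝ])
    (u : ℍ[ℝ]) (p : S3) :
    along V u (fun q => f q • k + g q • l) p = along V u f p • k + along V u g p • l := by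
  rw [along_add (hf.smul (smooth_const k)) (hg.smul (smooth_const l)), along_smul_const hf,
    along_smul_const hg]

/-- If `∂_u ψ = M(u) ψ` has a nonvanishing solution, where `M` is an invariant symmetric endomorphism
field which has the matrix `[[m, 0, 0], [0, a, b], [0, b, c]]`, then `M` is `0`, `diag(-1, 1, 1)` or
`-1`. -/
theorem matrix_classification (hV : IsInvariantFraming V) (hF : IsOrientedFrame c₁ c₂ c₃)
    {m a b c : S3 → ℝ} (hm : Smooth m) (ha : Smooth a) (hb : Smooth b) (hc : Smooth c)
    (hLm : ∀ p, along V c₁ m p = 0)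
    (hLa : ∀ p, along V c₁ a p = 4 * b p) (hLb : ∀ p, along V c₁ b p = 2 * (c p - a p))
    (hLc : ∀ p, along V c₁ c p = -(4 * b p))
    {ψ : S3 → ℍ[ℝ]} (hψ : Smooth ψ) (hψ0 : ∀ p, ψ p ≠ 0)
    (h₁ : ∀ p, along V c₁ ψ p = (m p • c₁) * ψ p)
    (h₂ : ∀ p, along V c₂ ψ p = (a p • c₂ + b p • c₃) * ψ p)
    (h₃ : ∀ p, along V c₃ ψ p = (b p • c₂ + c p • c₃) * ψ p) :
    (∀ p, m p = 0 ∧ a p = 0 ∧ b p = 0 ∧ c p = 0) ∨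
    (∀ p, m p = -1 ∧ a p = 1 ∧ b p = 0 ∧ c p = 1) ∨
    (∀ p, m p = -1 ∧ a p = -1 ∧ b p = 0 ∧ c p = -1) := by
  have hM₁ : Smooth fun p => m p • c₁ := hm.smul (smooth_const _)
  have hM₂ : Smooth fun p => a p • c₂ + b p • c₃ :=
    (ha.smul (smooth_const _)).add (hb.smul (smooth_const _))
  have hM₃ : Smooth fun p => b p • c₂ + c p • c₃ :=
    (hb.smul (smooth_const _)).add (hc.smul (smooth_const _))
  have i12 : ∀ p, (-along V c₂ m p) • c₁ + (along V c₁ a p + 2 * m p * b p - 2 * b p) • c₂ +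
      (along V c₁ b p - 2 * m p * a p - 2 * c p) • c₃ = 0 := fun p => by
    have h := integrability hV (K := fun p => (2 : ℝ) • (b p • c₂ + c p • c₃)) hψ hM₁ hM₂ h₁ h₂
      (fun q => by rw [hF.comm₁₂, along_smul_left, h₃, smul_mul_assoc]) (hψ0 p)
    rw [along_smul_const_add ha hb, along_smul_const hm] at h
    simp only [mul_add, add_mul, smul_mul_assoc, mul_smul_comm, smul_smul] at h
    linear_combination (norm := module) h + (m p * a p) • hF.comm₁₂ - (m p * b p) • hF.comm₃₁
  have i13 : ∀ p, (-along V c₃ m p) • c₁ + (along V c₁ b p + 2 * m p * c p + 2 * a p) • c₂ +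
      (along V c₁ c p - 2 * m p * b p + 2 * b p) • c₃ = 0 := fun p => by
    have h := integrability hV (K := fun p => (-2 : ℝ) • (a p • c₂ + b p • c₃)) hψ hM₁ hM₃ h₁ h₃
      (fun q => by
        rw [← neg_sub, hF.comm₃₁, ← neg_smul, along_smul_left, h₂, smul_mul_assoc]) (hψ0 p)
    rw [along_smul_const_add hb hc, along_smul_const hm] at h
    simp only [mul_add, add_mul, smul_mul_assoc, mul_smul_comm, smul_smul] at h
    linear_combination (norm := module) h + (m p * b p) • hF.comm₁₂ - (m p * c p) • hF.comm₃₁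
  have i23 : ∀ p, (-2 * (a p * c p - b p * b p) - 2 * m p) • c₁ +
      (along V c₂ b p - along V c₃ a p) • c₂ + (along V c₂ c p - along V c₃ b p) • c₃ = 0 :=
    fun p => by
    have h := integrability hV (K := fun p => (2 : ℝ) • (m p • c₁)) hψ hM₂ hM₃ h₂ h₃
      (fun q => by rw [hF.comm₂₃, along_smul_left, h₁]; simp only [smul_mul_assoc]) (hψ0 p)
    rw [along_smul_const_add hb hc, along_smul_const_add ha hb] at h
    simp only [mul_add, add_mul, smul_mul_assoc, mul_smul_comm, smul_smul] at h
    linear_combination (norm := module) h + (a p * c p - b p * b p) • hF.comm₂₃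
  have hconst : ∀ p q, m p = m q := eq_of_along_eq_zero hV hF hm hLm
    (fun p => neg_eq_zero.1 (hF.eq_zero (i12 p)).1) (fun p => neg_eq_zero.1 (hF.eq_zero (i13 p)).1)
  have ea : ∀ p, (1 + m p) * a p = 0 := fun p => by
    have h := (hF.eq_zero (i12 p)).2.2
    rw [hLb] at h
    linarith
  have eb : ∀ p, (1 + m p) * b p = 0 := fun p => by
    have h := (hF.eq_zero (i12 p)).2.1
    rw [hLa] at h
    linarith
  have ec : ∀ p, (1 + m p) * c p = 0 := fun p => by
    have h := (hF.eq_zero (i13 p)).2.1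
    rw [hLb] at h
    linarith
  have edet : ∀ p, a p * c p - b p * b p = -m p := fun p => by
    have h := (hF.eq_zero (i23 p)).1
    linarith
  by_cases h : ∀ p, 1 + m p = 0
  · have hm1 : ∀ p, m p = -1 := fun p => by linarith [h p]
    have hres := eq_one_or_neg_one_of_det_eq_one hV hF ha hb hc
      (fun p => by rw [edet, hm1, neg_neg])
      (fun p => sub_eq_zero.1 (hF.eq_zero (i23 p)).2.1)
      (fun p => sub_eq_zero.1 (hF.eq_zero (i23 p)).2.2) hLa hLb hLc
    exact Or.inr (hres.imp (fun h p => ⟨hm1 p, h p⟩) (fun h p => ⟨hm1 p, h p⟩))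
  · left
    push Not at h
    obtain ⟨q, hq⟩ := h
    intro p
    have hp : 1 + m p ≠ 0 := by rwa [hconst p q]
    have ha0 := (mul_eq_zero.1 (ea p)).resolve_left hp
    have hb0 := (mul_eq_zero.1 (eb p)).resolve_left hp
    have hc0 := (mul_eq_zero.1 (ec p)).resolve_left hp
    refine ⟨?_, ha0, hb0, hc0⟩
    have := edet p
    rw [ha0, hb0, hc0] at this
    linarith

end Core

/-! ### The spinor equation in the left-invariant trivialization -/

theorem mem_tangentAt {p : S3} {v : ℍ[ℝ]} : v ∈ tangentAt p ↔ ⟪(p : ℍ[ℝ]), v⟫_ℝ = 0 :=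
  Submodule.mem_orthogonal_singleton_iff_inner_right

theorem clifford_coe_mul (p : S3) {u : ℍ[ℝ]} (hu : u.re = 0) (φ : ℍ[ℝ]) :
    clifford p (p * u) φ = u * φ := by
  have hsum : u = ∑ a, ⟪imUnit a, u⟫_ℝ • imUnit a := by
    rw [Fin.sum_univ_three]
    ext <;> simp [inner_eq_sum, hu]
  simp only [clifford, frame, inner_coe_mul_coe_mul]
  conv_rhs => rw [hsum, Finset.sum_mul]
  simp only [smul_mul_assoc]

theorem re_star_mul_eq_zero {p : S3} {v : ℍ[ℝ]} (hv : v ∈ tangentAt p) :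
    (star (p : ℍ[ℝ]) * v).re = 0 := by
  rw [mem_tangentAt, inner_eq_sum] at hv
  simp only [Quaternion.re_mul, Quaternion.re_star, Quaternion.imI_star, Quaternion.imJ_star,
    Quaternion.imK_star]
  linarith

theorem clifford_eq {p : S3} {v : ℍ[ℝ]} (hv : v ∈ tangentAt p) (φ : ℍ[ℝ]) :
    clifford p v φ = star (p : ℍ[ℝ]) * v * φ := by
  rw [← clifford_coe_mul p (re_star_mul_eq_zero hv), ← mul_assoc, coe_mul_star, one_mul]

theorem frame_mem_tangentAt (a : Fin 3) (p : S3) : frame a p ∈ tangentAt p :=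
  mem_tangentAt.2 (isInvariantFraming_left.tangent _ (imUnit_re a) _)

theorem inner_leviCivita_frame {p : S3} {v : ℍ[ℝ]} (hv : v ∈ tangentAt p) (a b : Fin 3) :
    ⟪leviCivita (frame a) p v, frame b p⟫_ℝ =
      ⟪star (p : ℍ[ℝ]) * v * imUnit a, imUnit b⟫_ℝ := by
  have hd : diff (frame a) p v = v * imUnit a := diff_clm (leftFraming (imUnit a)) p
    (mem_tangentAt.1 hv)
  rw [leviCivita, hd, Submodule.inner_starProjection_left_eq_right,
    Submodule.starProjection_eq_self_iff.2 (frame_mem_tangentAt b p), frame,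
    ← inner_coe_mul_coe_mul p (star (p : ℍ[ℝ]) * v * imUnit a), ← mul_assoc, ← mul_assoc,
    coe_mul_star, one_mul]

theorem sum_inner_mul_imUnit {u : ℍ[ℝ]} (hu : u.re = 0) :
    ∑ a, ∑ b, ⟪u * imUnit a, imUnit b⟫_ℝ • (imUnit a * imUnit b) = (2 : ℝ) • u := by
  simp only [Fin.sum_univ_three]
  ext <;> simp [inner_eq_sum, hu] <;> ring

theorem spinConnection_eq (ψ : S3 → ℍ[ℝ]) {p : S3} {v : ℍ[ℝ]} (hv : v ∈ tangentAt p) :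
    spinConnection ψ p v = diff ψ p v + (1 / 2 : ℝ) • (star (p : ℍ[ℝ]) * v * ψ p) := by
  have hcl : ∀ (a : Fin 3) (φ : ℍ[ℝ]), clifford p (frame a p) φ = imUnit a * φ := fun a φ =>
    clifford_coe_mul p (imUnit_re a) φ
  have h := congrArg (· * ψ p) (sum_inner_mul_imUnit (re_star_mul_eq_zero hv))
  simp only [Finset.sum_mul, smul_mul_assoc, mul_assoc] at h
  simp only [spinConnection, inner_leviCivita_frame hv, hcl, mul_assoc]
  rw [h, smul_smul]
  norm_num

theorem IsSymmEndField.mem_tangentAt {A : S3 → ℍ[ℝ] →L[ℝ] ℍ[ℝ]} (hA : IsSymmEndField A) (p : S3)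
    (v : ℍ[ℝ]) : A p v ∈ tangentAt p := by
  rw [CauchyS3.mem_tangentAt, ← hA.symm, hA.normal, inner_zero_left]

theorem IsSymmEndField.neg {A : S3 → ℍ[ℝ] →L[ℝ] ℍ[ℝ]} (hA : IsSymmEndField A) :
    IsSymmEndField (fun p => -A p) where
  smooth := hA.smooth.neg
  symm p v w := by simp [hA.symm]
  normal p := by simp [hA.normal]

/-- In the left-invariant trivialization, the equation of a Cauchy spinor says that
`dψ ψ⁻¹ = -1/2 p⁻¹ (A + 1)`. -/
theorem IsCauchySpinor.diff_eq {A : S3 → ℍ[ℝ] →L[ℝ] ℍ[ℝ]} (hA : IsSymmEndField A)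
    {ψ : S3 → ℍ[ℝ]} (hψ : IsCauchySpinor A ψ) {p : S3} {v : ℍ[ℝ]} (hv : v ∈ tangentAt p) :
    diff ψ p v = (-(1 / 2) : ℝ) • (star (p : ℍ[ℝ]) * (A p v + v) * ψ p) := by
  have h := hψ.eqn p v hv
  rw [spinConnection_eq ψ hv, clifford_eq (hA.mem_tangentAt p v)] at h
  rw [eq_sub_of_add_eq h, mul_add, add_mul]
  module

theorem inner_mul_self_right {u : ℍ[ℝ]} (hu : u.re = 0) (φ : ℍ[ℝ]) : ⟪u * φ, φ⟫_ℝ = 0 := by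
  simp only [inner_eq_sum, Quaternion.re_mul, Quaternion.imI_mul, Quaternion.imJ_mul,
    Quaternion.imK_mul, hu]
  ring

/-- A Cauchy spinor has constant length. -/
theorem IsCauchySpinor.apply_ne_zero {A : S3 → ℍ[ℝ] →L[ℝ] ℍ[ℝ]} (hA : IsSymmEndField A)
    {ψ : S3 → ℍ[ℝ]} (hψ : IsCauchySpinor A ψ) (p : S3) : ψ p ≠ 0 := by
  have hconst : ∀ p q, ⟪ψ p, ψ p⟫_ℝ = ⟪ψ q, ψ q⟫_ℝ := by
    refine eq_of_diff_eq_zero (hψ.smooth.inner hψ.smooth) fun p v hv => ?_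
    have hv := mem_tangentAt.2 hv
    have h := inner_mul_self_right (re_star_mul_eq_zero
      ((tangentAt p).add_mem (hA.mem_tangentAt p v) hv)) (ψ p)
    rw [diff_inner hψ.smooth hψ.smooth, real_inner_comm, hψ.diff_eq hA hv, real_inner_smul_right,
      real_inner_comm, h]
    simp
  obtain ⟨q, hq⟩ := Function.ne_iff.1 hψ.ne_zero
  intro hp
  have h := hconst q p
  rw [hp, inner_zero_left] at h
  exact hq (inner_self_eq_zero.1 h)

/-! ### Invariant endomorphism fields in an invariant framing -/

section Framing

variable {V : ℍ[ℝ] →L[ℝ] ℍ[ℝ] →L[ℝ] ℍ[ℝ]} {c₁ c₂ c₃ : ℍ[ℝ]}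

theorem IsInvariantFraming.isVectorField (hV : IsInvariantFraming V) {u : ℍ[ℝ]} (hu : u.re = 0) :
    IsVectorField (fun p => V u p) :=
  ⟨smooth_clm (V u), fun p => mem_tangentAt.2 (hV.tangent u hu p)⟩

theorem IsInvariantFraming.expand (hV : IsInvariantFraming V) (hF : IsOrientedFrame c₁ c₂ c₃)
    {p : S3} {v : ℍ[ℝ]} (hv : v ∈ tangentAt p) :
    v = ⟪v, V c₁ p⟫_ℝ • V c₁ p + ⟪v, V c₂ p⟫_ℝ • V c₂ p + ⟪v, V c₃ p⟫_ℝ • V c₃ p := by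
  obtain ⟨u, hu, rfl⟩ := hV.surj p v (mem_tangentAt.1 hv)
  simp only [hV.isometry]
  obtain ⟨x, y, z, rfl⟩ := hF.span u hu
  have h₁ := hF.inner_comb x y z 1 0 0
  have h₂ := hF.inner_comb x y z 0 1 0
  have h₃ := hF.inner_comb x y z 0 0 1
  simp only [one_smul, zero_smul, add_zero, zero_add, mul_one, mul_zero] at h₁ h₂ h₃
  rw [h₁, h₂, h₃]
  simp

theorem IsInvariantFraming.eq_zero (hV : IsInvariantFraming V) (hF : IsOrientedFrame c₁ c₂ c₃)
    {p : S3} {x y z : ℝ} (h : x • V c₁ p + y • V c₂ p + z • V c₃ p = 0) :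
    x = 0 ∧ y = 0 ∧ z = 0 := by
  refine hF.eq_zero (x := x) (y := y) (z := z) (inner_self_eq_zero (𝕜 := ℝ).1 ?_)
  rw [← hV.isometry _ _ p]
  have : V (x • c₁ + y • c₂ + z • c₃) p = 0 := by simpa using h
  rw [this, inner_zero_left]

/-- The Lie derivative along `V k` in terms of the coefficients `g`, `h` of `A (V u)`. -/
theorem lieDerivEnd_framing (hV : IsInvariantFraming V) {A : S3 → ℍ[ℝ] →L[ℝ] ℍ[ℝ]}
    (hA : IsSymmEndField A) {k u x y : ℍ[ℝ]} (hk : k.re = 0) (hu : u.re = 0)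
    {g h : S3 → ℝ} (hg : Smooth g) (hh : Smooth h) (hAu : ∀ q : S3, A q (V u q) = g q • V x q + h q • V y q) (p : S3) :
    lieDerivEnd (fun q => V k q) A (fun q => V u q) p =
      along V k g p • V x p + along V k h p • V y p + g p • V (k * x - x * k) p +
        h p • V (k * y - y * k) p - A p (V (k * u - u * k) p) := by
  have hkp := hV.tangent k hk p
  have hd : diff (fun q => A q (V u q)) p (V k p) =
      along V k g p • V x p + g p • V x (V k p) + (along V k h p • V y p + h p • V y (V k p)) := by
    rw [funext hAu, diff_add (hg.smul (smooth_clm (V x))) (hh.smul (smooth_clm (V y))),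
      diff_smul hg (smooth_clm (V x)), diff_smul hh (smooth_clm (V y)), diff_clm (V x) p hkp,
      diff_clm (V y) p hkp, along, along]
  rw [lieDerivEnd, bracket, bracket, hd,
    diff_clm (V k) p (mem_tangentAt.1 (hA.mem_tangentAt p _)), diff_clm (V u) p hkp,
    diff_clm (V k) p (hV.tangent u hu p), hAu, ← hV.comm, ← hV.comm, ← hV.comm, map_add, map_smul,
    map_smul]
  module

theorem lieDerivEnd_neg (ξ : S3 → ℍ[ℝ]) (A : S3 → ℍ[ℝ] →L[ℝ] ℍ[ℝ]) (X : S3 → ℍ[ℝ]) (p : S3) :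
    lieDerivEnd ξ (fun q => -A q) X p = -lieDerivEnd ξ A X p := by
  simp only [lieDerivEnd, bracket, neg_apply, diff_neg]
  simp only [diff, map_neg]
  abel

theorem lineTensor_smul_left {k : ℝ} (hk : k ≠ 0) {x : ℍ[ℝ]} (hx : ‖x‖ = 1) (v : ℍ[ℝ]) :
    lineTensor (k • x) v = ⟪x, v⟫_ℝ • x := by
  rw [lineTensor, norm_smul, hx, real_inner_smul_left, smul_smul, mul_one, Real.norm_eq_abs, sq_abs]
  congr 1
  field_simp

theorem perpProj_eq {p : S3} {x v : ℍ[ℝ]} (hx : x ∈ tangentAt p) (hx0 : x ≠ 0)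
    (hv : v ∈ tangentAt p) : perpProj p x v = v - lineTensor x v := by
  refine Submodule.eq_starProjection_of_mem_of_inner_eq_zero ?_ ?_
  · refine ⟨(tangentAt p).sub_mem hv ((tangentAt p).smul_mem _ hx),
      Submodule.mem_orthogonal_singleton_iff_inner_right.2 ?_⟩
    rw [lineTensor, inner_sub_right, real_inner_smul_right, real_inner_self_eq_norm_sq]
    have : ‖x‖ ≠ 0 := norm_ne_zero_iff.2 hx0
    field_simp
    ring
  · rintro w ⟨-, hw⟩
    rw [sub_sub_cancel, lineTensor, real_inner_smul_left,
      Submodule.mem_orthogonal_singleton_iff_inner_right.1 hw, mul_zero]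

/-- In an invariant framing, `L_ξ A = 0` for `ξ = r V c₁` determines the derivatives along `V c₁` of
the coefficients of `A`. -/
theorem along_coeff_of_lieDerivEnd_eq_zero (hV : IsInvariantFraming V)
    (hF : IsOrientedFrame c₁ c₂ c₃) {A : S3 → ℍ[ℝ] →L[ℝ] ℍ[ℝ]} (hA : IsSymmEndField A) {r : ℝ}
    (hr : r ≠ 0)
    (hLie : ∀ X, IsVectorField X → ∀ p, lieDerivEnd (fun q => V (r • c₁) q) A X p = 0)
    {m a b c : S3 → ℝ} (hm : Smooth m) (ha : Smooth a) (hb : Smooth b) (hc : Smooth c)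
    (h₁ : ∀ p : S3, A p (V c₁ p) = m p • V c₁ p)
    (h₂ : ∀ p : S3, A p (V c₂ p) = a p • V c₂ p + b p • V c₃ p)
    (h₃ : ∀ p : S3, A p (V c₃ p) = b p • V c₂ p + c p • V c₃ p) (p : S3) :
    along V c₁ m p = 0 ∧ along V c₁ a p = 4 * b p ∧ along V c₁ b p = 2 * (c p - a p) ∧
      along V c₁ c p = -(4 * b p) := by
  have hk : (r • c₁).re = 0 := by simp [hF.re₁]
  have hcomm : ∀ u : ℍ[ℝ], V ((r • c₁) * u - u * (r • c₁)) p = r • V (c₁ * u - u * c₁) p := by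
    intro u
    rw [smul_mul_assoc, mul_smul_comm, ← smul_sub, map_smul, smul_apply]
  have hc₁₃ : c₁ * c₃ - c₃ * c₁ = (-2 : ℝ) • c₂ := by rw [← neg_sub, hF.comm₃₁, neg_smul]
  have e₁ := lieDerivEnd_framing (y := 0) hV hA hk hF.re₁ hm (smooth_const (0 : ℝ))
    (fun q => by rw [h₁, zero_smul, add_zero]) p
  have e₂ := lieDerivEnd_framing hV hA hk hF.re₂ ha hb h₂ p
  have e₃ := lieDerivEnd_framing hV hA hk hF.re₃ hb hc h₃ p
  rw [hLie _ (hV.isVectorField hF.re₁)] at e₁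
  rw [hLie _ (hV.isVectorField hF.re₂)] at e₂
  rw [hLie _ (hV.isVectorField hF.re₃)] at e₃
  simp only [hcomm, along_smul_left, hF.comm₁₂, hc₁₃, sub_self, map_zero, map_smul, smul_apply, h₂,
    h₃, zero_apply, smul_zero, zero_smul, add_zero, sub_zero, smul_eq_mul] at e₁ e₂ e₃
  have f₁ := hV.eq_zero hF (p := p) (x := r * along V c₁ m p) (y := 0) (z := 0)
    (by rw [zero_smul, zero_smul, add_zero, add_zero]; exact e₁.symm)
  have f₂ := hV.eq_zero hF (p := p) (x := 0) (y := r * (along V c₁ a p - 4 * b p))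
    (z := r * (along V c₁ b p - 2 * (c p - a p)))
    (by linear_combination (norm := module) (-1 : ℝ) • e₂)
  have f₃ := hV.eq_zero hF (p := p) (x := 0) (y := r * (along V c₁ b p - 2 * (c p - a p)))
    (z := r * (along V c₁ c p + 4 * b p))
    (by linear_combination (norm := module) (-1 : ℝ) • e₃)
  have g₁ := (mul_eq_zero.1 f₁.1).resolve_left hr
  have g₂ := (mul_eq_zero.1 f₂.2.1).resolve_left hr
  have g₃ := (mul_eq_zero.1 f₂.2.2).resolve_left hr
  have g₄ := (mul_eq_zero.1 f₃.2.2).resolve_left hr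
  exact ⟨g₁, by linarith, by linarith, by linarith⟩

/-- The matrix of a symmetric endomorphism field with eigenvector `V c₁`. -/
theorem IsSymmEndField.exists_coeff {A : S3 → ℍ[ℝ] →L[ℝ] ℍ[ℝ]} (hA : IsSymmEndField A)
    (hV : IsInvariantFraming V) (hF : IsOrientedFrame c₁ c₂ c₃) {f : S3 → ℝ}
    (hf₁ : ∀ p : S3, A p (V c₁ p) = f p • V c₁ p) :
    ∃ m a b c : S3 → ℝ, Smooth m ∧ Smooth a ∧ Smooth b ∧ Smooth c ∧
      (∀ p : S3, A p (V c₁ p) = m p • V c₁ p) ∧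
      (∀ p : S3, A p (V c₂ p) = a p • V c₂ p + b p • V c₃ p) ∧
      (∀ p : S3, A p (V c₃ p) = b p • V c₂ p + c p • V c₃ p) := by
  have hsm : ∀ u w : ℍ[ℝ], Smooth fun p : S3 => ⟪A p (V u p), V w p⟫_ℝ := fun u w =>
    (hA.smooth.clm_apply (smooth_clm (V u))).inner (smooth_clm (V w))
  have hfm : ∀ p : S3, ⟪A p (V c₁ p), V c₁ p⟫_ℝ = f p := fun p => by
    rw [hf₁, real_inner_smul_left, hV.isometry, hF.inner₁₁, mul_one]
  have h₁ : ∀ p : S3, A p (V c₁ p) = ⟪A p (V c₁ p), V c₁ p⟫_ℝ • V c₁ p := fun p => by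
    rw [hfm, hf₁]
  have h₂ : ∀ p : S3, A p (V c₂ p) =
      ⟪A p (V c₂ p), V c₂ p⟫_ℝ • V c₂ p + ⟪A p (V c₂ p), V c₃ p⟫_ℝ • V c₃ p := fun p => by
    conv_lhs => rw [hV.expand hF (hA.mem_tangentAt p (V c₂ p))]
    rw [hA.symm p (V c₂ p) (V c₁ p), hf₁, real_inner_smul_right, hV.isometry, real_inner_comm,
      hF.inner₁₂, mul_zero, zero_smul, zero_add]
  have h₃ : ∀ p : S3, A p (V c₃ p) =
      ⟪A p (V c₂ p), V c₃ p⟫_ℝ • V c₂ p + ⟪A p (V c₃ p), V c₃ p⟫_ℝ • V c₃ p := fun p => by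
    conv_lhs => rw [hV.expand hF (hA.mem_tangentAt p (V c₃ p))]
    rw [hA.symm p (V c₃ p) (V c₁ p), hf₁, real_inner_smul_right, hV.isometry, real_inner_comm,
      hF.inner₁₃, mul_zero, zero_smul, zero_add, hA.symm p (V c₃ p) (V c₂ p), real_inner_comm]
  exact ⟨_, _, _, _, hsm c₁ c₁, hsm c₂ c₂, hsm c₂ c₃, hsm c₃ c₃, h₁, h₂, h₃⟩

theorem along_affine {f : S3 → ℝ} (hf : Smooth f) (k l : ℝ) (u : ℍ[ℝ]) (p : S3) :
    along V u (fun q => k * f q + l) p = k * along V u f p := by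
  rw [along_add ((smooth_const k).mul hf) (smooth_const l), along_mul (smooth_const k) hf,
    along_const, along_const]
  ring

/-- The classification, for a vector field `V k` of an invariant framing and a solution of the
spinor equation `dψ ψ⁻¹ = -1/2 (A + 1)`, where `A` is read in the framing. -/
theorem classification (hV : IsInvariantFraming V) {A : S3 → ℍ[ℝ] →L[ℝ] ℍ[ℝ]}
    (hA : IsSymmEndField A) {k : ℍ[ℝ]} (hk : k.re = 0) (hk0 : k ≠ 0)
    (hLie : ∀ X, IsVectorField X → ∀ p, lieDerivEnd (fun q => V k q) A X p = 0)
    (hEig : ∃ f : S3 → ℝ, ∀ p : S3, A p (V k p) = f p • V k p)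
    {ψ : S3 → ℍ[ℝ]} (hψ : Smooth ψ) (hψ0 : ∀ p, ψ p ≠ 0)
    (heq : ∀ (p : S3) (u w : ℍ[ℝ]), u.re = 0 → w.re = 0 → A p (V u p) = V w p →
      along V u ψ p = (-(1 / 2) : ℝ) • ((w + u) * ψ p)) :
    (∀ p, ∀ v ∈ tangentAt p, A p v = v) ∨
    (∀ p, ∀ v ∈ tangentAt p, A p v = -v) ∨
    (∀ p : S3, ∀ v ∈ tangentAt p,
      A p v = lineTensor (V k p) v - (3 : ℝ) • perpProj p (V k p) v) := by
  have hn : ‖k‖ ≠ 0 := norm_ne_zero_iff.2 hk0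
  obtain ⟨r, c₁, hr, hkr, hc₁, hc₁'⟩ : ∃ (r : ℝ) (c₁ : ℍ[ℝ]), r ≠ 0 ∧ k = r • c₁ ∧ c₁.re = 0 ∧
      ⟪c₁, c₁⟫_ℝ = 1 := by
    refine ⟨‖k‖, ‖k‖⁻¹ • k, hn, by rw [smul_smul, mul_inv_cancel₀ hn, one_smul], by simp [hk], ?_⟩
    rw [real_inner_smul_left, real_inner_smul_right, real_inner_self_eq_norm_sq]
    field_simp
  obtain ⟨c₂, c₃, hF⟩ := exists_isOrientedFrame hc₁ hc₁'
  obtain ⟨f, hf⟩ := hEig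
  have hf₁ : ∀ p : S3, A p (V c₁ p) = f p • V c₁ p := fun p => by
    have h := hf p
    rw [hkr, map_smul, smul_apply, map_smul, smul_comm] at h
    exact smul_right_injective _ hr h
  obtain ⟨m, a, b, c, hm, ha, hb, hc, h₁, h₂, h₃⟩ := hA.exists_coeff hV hF hf₁
  subst hkr
  have hL := along_coeff_of_lieDerivEnd_eq_zero hV hF hA hr hLie hm ha hb hc h₁ h₂ h₃
  have haff : ∀ {g : S3 → ℝ} (l : ℝ), Smooth g → Smooth fun p => -(1 / 2) * g p + l :=
    fun l hg => ((smooth_const _).mul hg).add (smooth_const l)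
  -- the coefficients of `-1/2 (A + 1)`
  have key := matrix_classification hV hF (haff (-(1 / 2)) hm) (haff (-(1 / 2)) ha) (haff 0 hb)
    (haff (-(1 / 2)) hc)
    (fun p => by rw [along_affine hm, (hL p).1, mul_zero])
    (fun p => by rw [along_affine ha, (hL p).2.1]; ring)
    (fun p => by rw [along_affine hb, (hL p).2.2.1]; ring)
    (fun p => by rw [along_affine hc, (hL p).2.2.2]; ring) hψ hψ0
    (fun p => by
      rw [heq p c₁ (m p • c₁) hF.re₁ (by simp [hF.re₁]) (by rw [h₁]; simp), ← smul_mul_assoc]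
      congr 1
      module)
    (fun p => by
      rw [heq p c₂ (a p • c₂ + b p • c₃) hF.re₂ (by simp [hF.re₂, hF.re₃]) (by rw [h₂]; simp),
        ← smul_mul_assoc]
      congr 1
      module)
    (fun p => by
      rw [heq p c₃ (b p • c₂ + c p • c₃) hF.re₃ (by simp [hF.re₂, hF.re₃]) (by rw [h₃]; simp),
        ← smul_mul_assoc]
      congr 1
      module)
  have hAv : ∀ (p : S3) (x y z : ℝ), A p (x • V c₁ p + y • V c₂ p + z • V c₃ p) =
      (x * m p) • V c₁ p + (y * a p + z * b p) • V c₂ p + (y * b p + z * c p) • V c₃ p := by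
    intro p x y z
    rw [map_add, map_add, map_smul, map_smul, map_smul, h₁, h₂, h₃]
    module
  rcases key with h | h | h
  · refine Or.inr (Or.inl fun p v hv => ?_)
    obtain ⟨e₁, e₂, e₃, e₄⟩ := h p
    rw [hV.expand hF hv, hAv, show m p = -1 by linarith, show a p = -1 by linarith,
      show b p = 0 by linarith, show c p = -1 by linarith]
    module
  · refine Or.inr (Or.inr fun p v hv => ?_)
    obtain ⟨e₁, e₂, e₃, e₄⟩ := h p
    have hmem : V (r • c₁) p ∈ tangentAt p := mem_tangentAt.2 (hV.tangent _ hk _)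
    have hnorm : ‖V c₁ (p : ℍ[ℝ])‖ = 1 := by
      rw [norm_eq_sqrt_real_inner, hV.isometry, hF.inner₁₁, Real.sqrt_one]
    have hne : V (r • c₁) (p : ℍ[ℝ]) ≠ 0 := by
      rw [map_smul, smul_apply]
      exact smul_ne_zero hr (norm_ne_zero_iff.1 (by rw [hnorm]; exact one_ne_zero))
    rw [perpProj_eq hmem hne hv, map_smul, smul_apply, lineTensor_smul_left hr hnorm,
      real_inner_comm]
    have hv' := hV.expand hF hv
    -- hides the `v` in this coefficient from the rewriting of `v` below
    set x := ⟪v, V c₁ p⟫_ℝ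
    rw [hv', hAv, show m p = 1 by linarith, show a p = -3 by linarith,
      show b p = 0 by linarith, show c p = -3 by linarith]
    module
  · refine Or.inl fun p v hv => ?_
    obtain ⟨e₁, e₂, e₃, e₄⟩ := h p
    rw [hV.expand hF hv, hAv, show m p = 1 by linarith, show a p = 1 by linarith,
      show b p = 0 by linarith, show c p = 1 by linarith]
    module

end Framing

end CauchyS3

open CauchyS3 in
theorem proposition6p4
    (A : S3 → ℍ[ℝ] →L[ℝ] ℍ[ℝ]) (hA : A ∈ cauchyEndomorphisms)
    (ξ : S3 → ℍ[ℝ]) (hξ : IsVectorField ξ) (hξ0 : ∀ p, ξ p ≠ 0)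
    (hLie : ∀ X, IsVectorField X → ∀ p, lieDerivEnd ξ A X p = 0)
    (hEig : ∃ f : S3 → ℝ, ∀ p, A p (ξ p) = f p • ξ p) :
    (IsLeftInvariant ξ →
      (∀ p, ∀ v ∈ tangentAt p, A p v = v) ∨
      (∀ p, ∀ v ∈ tangentAt p, A p v = -v) ∨
      (∀ p, ∀ v ∈ tangentAt p,
        A p v = lineTensor (ξ p) v - (3 : ℝ) • perpProj p (ξ p) v)) ∧
    (IsRightInvariant ξ →
      (∀ p, ∀ v ∈ tangentAt p, A p v = v) ∨
      (∀ p, ∀ v ∈ tangentAt p, A p v = -v) ∨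
      (∀ p, ∀ v ∈ tangentAt p,
        A p v = -lineTensor (ξ p) v + (3 : ℝ) • perpProj p (ξ p) v)) := by
  obtain ⟨hsymm, ψ, hψ⟩ := hA
  have hre : (ξ 1).re = 0 := by
    have := mem_tangentAt.1 (hξ.tangent 1)
    rw [inner_eq_sum] at this
    simpa using this
  constructor
  · intro hinv
    have hξ1 : ξ = fun p : S3 => leftFraming (ξ 1) p := funext fun p => by
      rw [leftFraming_apply, ← hinv p 1, mul_one]
    rw [hξ1] at hLie hEig
    have h := classification isInvariantFraming_left hsymm hre (hξ0 1) hLie hEig hψ.smooth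
      (hψ.apply_ne_zero hsymm) (fun p u w hu _ hw => by
        have hu' := mem_tangentAt.2 (isInvariantFraming_left.tangent u hu p)
        rw [along, hψ.diff_eq hsymm hu', hw, leftFraming_apply, leftFraming_apply, ← mul_add,
          ← mul_assoc, star_mul_coe, one_mul])
    rw [hξ1]
    exact h
  · intro hinv
    have hξ1 : ξ = fun p : S3 => rightFraming (-ξ 1) p := funext fun p => by
      rw [rightFraming_apply, neg_mul, neg_neg, ← hinv p 1, one_mul]
    rw [hξ1] at hLie hEig
    -- `p ψ` solves the equation for `-A` in the right-invariant framing
    have h := classification (k := -ξ 1) (ψ := fun p => (p : ℍ[ℝ]) * ψ p) isInvariantFraming_right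
      hsymm.neg (by simp [hre]) (neg_ne_zero.2 (hξ0 1))
      (fun X hX p => by
        rw [lieDerivEnd_neg, hLie X hX p, neg_zero])
      (by
        obtain ⟨f, hf⟩ := hEig
        exact ⟨fun p => -f p, fun p => by rw [neg_apply, hf, neg_smul]⟩)
      ((smooth_clm (ContinuousLinearMap.id ℝ ℍ[ℝ])).quaternion_mul hψ.smooth)
      (fun p => mul_ne_zero (coe_ne_zero p) (hψ.apply_ne_zero hsymm p))
      (fun p u w hu _ hw => by
        have hu' := mem_tangentAt.2 (isInvariantFraming_right.tangent u hu p)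
        have hw' : A p (rightFraming u p) = w * p := by
          rw [← neg_inj, ← neg_apply, hw, rightFraming_apply]
        rw [along, diff_quaternion_mul (f := fun q => (q : ℍ[ℝ]))
          (smooth_clm (ContinuousLinearMap.id ℝ ℍ[ℝ])) hψ.smooth,
          diff_coe p (mem_tangentAt.1 hu'), hψ.diff_eq hsymm hu', hw', rightFraming_apply,
          mul_smul_comm, ← mul_assoc, ← mul_assoc, coe_mul_star, one_mul]
        simp only [add_mul, neg_mul, mul_assoc]
        module)
    simp only [neg_apply] at h
    rw [hξ1]
    rcases h with h | h | h
    · exact Or.inr (Or.inl fun p v hv => neg_eq_iff_eq_neg.1 (h p v hv))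
    · exact Or.inl fun p v hv => neg_inj.1 (h p v hv)
    · refine Or.inr (Or.inr fun p v hv => ?_)
      rw [← neg_inj, h p v hv]
      abel
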